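/- **Setting.** Let $\gamma>0$ and let $(X,d,\mu)$ be an Ahlfors $\gamma$-regular space: $(X,d)$ is a metric space and $\mu$ a Borel measure such that, for some constants $c_1,c_2>0$, $c_1r^\gamma\le\mu(B(x,r))\le c_2r^\gamma$ for all $x\in X$ and $r>0$, where $B(x,r)$ is the open ball. Functions are real valued. For $\sigma>0$ put $$\mathscr E_\sigma(u)=\iint_{X\times X}\frac{|u(x)-u(y)|^2}{\mu(B(x,d(x,y)))^{1+2\sigma}}\,d\mu(x)\,d\mu(y),$$ $H^\sigma_{d,\mu}=\{u\in L^2(X,\mu):\mathscr E_\sigma(u)<\infty\}$ and $\|u\|_{H^\sigma_{d,\mu}}=\|u\|_{L^2}+\sqrt{\mathscr E_\sigma(u)}$. A *space of coercivity* for $\mathscr E_\sigma$ is a linear subspace $W$ of $H^\sigma_{d,\mu}$, closed for the norm of $H^\sigma_{d,\mu}$, such that for some $c>0$ one has $\mathscr E_\sigma(u)\ge c\|u\|_{L^2}^2$ for all $u\in W$. For $s>0$ let $$B(u,v)=\iint_{X\times X}\frac{u(x)-u(y)}{d(x,y)^s}\,\frac{v(x)-v(y)}{d(x,y)^s}\,\frac{d\mu(x)\,d\mu(y)}{d(x,y)^\gamma}.$$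 **Dyadic and Haar systems.** A *dyadic system* is a family $\mathcal D=\bigcup_{j\in\mathbb Z}\mathcal D_j$ in which each $\mathcal D_j$ is a partition of $X$ into nonempty Borel sets (the cubes of level $j$) such that: for some $0<\nu<1$ and constants $0<c\le C$, every $Q\in\mathcal D_j$ satisfies $c\nu^j\le\operatorname{diam}Q\le C\nu^j$ and $c\le\sup\{r_1/r_2\}\le C$, the supremum being over all $r_1,r_2>0$ and all balls with $B(x_1,r_1)\subseteq Q\subseteq B(x_2,r_2)$; every $Q\in\mathcal D_{j+1}$ lies in exactly one cube of $\mathcal D_j$; for some $M$, every $Q\in\mathcal D_j$ contains at least one and at most $M$ cubes of $\mathcal D_{j+1}$ (its children); any two cubes are disjoint or nested; and for every cube $Q$ the union of all the cubes containing $Q$ is $X$. Let $P_j$ be the orthogonal projector of $L^2(X,\mu)$ onto the subspace of the functions that are constant on each cube of $\mathcal D_j$. A *Haar system* $\mathscr H$ consists of one set $\mathscr H_j(Q)\subset L^2(X,\mu)$ for each $j\in\mathbb Z$ and $Q\in\mathcal D_j$, such that $\mathscr H_j(Q)$ together with a further element $\mathcal X_Q/\sqrt{\mu(Q)}$ forms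 an orthonormal basis of the space of the functions that vanish outside $Q$ and are constant on each child of $Q$. For $\lambda>0$ let $\Pi_\lambda$ be the orthogonal projector of $L^2(X,\mu)$ onto the closed linear span of all $\mathscr H_j(Q)$ with $\mu(Q)>\lambda$. **Theorem.** Let $s>\gamma/2$. Let $H^{s/\gamma,0}_{d,\mu}$ be any space of coercivity for $\mathscr E_{s/\gamma}$. Each element $v$ of $H^{s/\gamma,0}_{d,\mu}$ has exactly one continuous representative, so that the values $v(x)$, $x\in X$, are well defined, and there is a function $\mathcal G:X\times X\to\mathbb R$ such that, for each $x\in X$, $\mathcal G(x,\cdot)$ belongs to $H^{s/\gamma,0}_{d,\mu}$ (and is continuous) and $$B(\mathcal G(x,\cdot),v)=v(x)\qquad\text{for every }v\in H^{s/\gamma,0}_{d,\mu},$$ the integral on the left being absolutely convergent. In particular this holds for each of the spaces $\{u\in H^{s/\gamma}_{d,\mu}:P_ju=0\}$, $j\in\mathbb Z$, and $\{u\in H^{s/\gamma}_{d,\mu}:\Pi_\lambda u=0\}$, $\lambda>0$, for any dyadic system and any Haar system associated with it: all of these are spaces of coercivity for $\mathscr E_{s/\gamma}$. -/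

import Mathlib

open MeasureTheory Set Metric
open scoped ENNReal

namespace FracGreen

noncomputable section

variable {X : Type*} [MetricSpace X] [MeasurableSpace X]

/-- Ahlfors `γ`-regularity: `c₁ r^γ ≤ μ(B(x,r)) ≤ c₂ r^γ` for every point `x` and every `r > 0`. -/
def AhlforsRegular (γ : ℝ) (μ : Measure X) : Prop :=
  ∃ c₁ c₂ : ℝ, 0 < c₁ ∧ 0 < c₂ ∧ ∀ (x : X) (r : ℝ), 0 < r →
    ENNReal.ofReal (c₁ * r ^ γ) ≤ μ (ball x r) ∧ μ (ball x r) ≤ ENNReal.ofReal (c₂ * r ^ γ)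

/-! ### Energy, fractional Sobolev spaces, coercivity -/

/-- The energy `∬ |u(x) - u(y)|² / μ(B(x,d(x,y)))^(1+2σ) dμ(x) dμ(y)`
(the integrand vanishes on the diagonal, since `0 / 0 = 0` in `ℝ≥0∞`). -/
def energy (μ : Measure X) (σ : ℝ) (u : X → ℝ) : ℝ≥0∞ :=
  ∫⁻ z : X × X, ENNReal.ofReal ((u z.1 - u z.2) ^ 2) /
    (μ (ball z.1 (dist z.1 z.2))) ^ (1 + 2 * σ) ∂(μ.prod μ)

/-- The space `H^σ_{d,μ}` of `L²` functions with finite energy. -/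
def sobolevSpace (μ : Measure X) (σ : ℝ) : Set (Lp ℝ 2 μ) :=
  {u | energy μ σ u < ∞}

/-- The norm `‖u‖_{L²} + √(energy u)` of `H^σ_{d,μ}`, with value `∞` off that space. -/
def sobolevNorm (μ : Measure X) (σ : ℝ) (u : Lp ℝ 2 μ) : ℝ≥0∞ :=
  ‖u‖ₑ + (energy μ σ u) ^ (1 / 2 : ℝ)

/-- `W` is a space of coercivity: a Hilbert (that is, norm-closed linear) subspace of `H^σ_{d,μ}`
on which the energy dominates a positive multiple of the square of the `L²` norm. -/
structure IsCoercivitySpace (μ : Measure X) (σ : ℝ) (W : Set (Lp ℝ 2 μ)) : Prop where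
  subspace : ∃ S : Submodule ℝ (Lp ℝ 2 μ), (S : Set (Lp ℝ 2 μ)) = W
  subset_sobolev : W ⊆ sobolevSpace μ σ
  closed : ∀ u ∈ sobolevSpace μ σ,
    (∀ ε : ℝ≥0∞, 0 < ε → ∃ w ∈ W, sobolevNorm μ σ (w - u) < ε) → u ∈ W
  coercive : ∃ c : ℝ, 0 < c ∧ ∀ u ∈ W, ENNReal.ofReal c * ‖u‖ₑ ^ 2 ≤ energy μ σ u

/-! ### The Dirichlet form and Green functions -/

/-- The integrand of the Dirichlet form. -/
def dirichletIntegrand (γ s : ℝ) (u v : X → ℝ) (z : X × X) : ℝ :=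
  (u z.1 - u z.2) / dist z.1 z.2 ^ s * ((v z.1 - v z.2) / dist z.1 z.2 ^ s) / dist z.1 z.2 ^ γ

/-- The bilinear form `B(u,v)`. -/
def dirichletForm (μ : Measure X) (γ s : ℝ) (u v : X → ℝ) : ℝ :=
  ∫ z : X × X, dirichletIntegrand γ s u v z ∂(μ.prod μ)

/-- The function `f` is a continuous representative of the `L²` class `u`. -/
def IsContRep (μ : Measure X) (f : X → ℝ) (u : Lp ℝ 2 μ) : Prop :=
  Continuous f ∧ f =ᵐ[μ] u

/-- `G` is a Green function for `B` on `W`: each `G(x,·)` is (the continuous representative of)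
an element of `W`, and `B(G(x,·), v) = v(x)` for every `v ∈ W`, where the value `v(x)` is that of
the continuous representative; the integral that defines `B(G(x,·), v)` converges absolutely. -/
def IsGreenFunction (μ : Measure X) (γ s : ℝ) (W : Set (Lp ℝ 2 μ)) (G : X → X → ℝ) : Prop :=
  ∀ x : X, (∃ g ∈ W, IsContRep μ (G x) g) ∧
    ∀ w ∈ W, ∀ v : X → ℝ, IsContRep μ v w →
      Integrable (dirichletIntegrand γ s (G x) v) (μ.prod μ) ∧
      dirichletForm μ γ s (G x) v = v x

/-- Point evaluation is well defined on `W`, and there is a Green function on `W`. -/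
def HasGreenFunction (μ : Measure X) (γ s : ℝ) (W : Set (Lp ℝ 2 μ)) : Prop :=
  (∀ w ∈ W, ∃! v : X → ℝ, IsContRep μ v w) ∧ ∃ G : X → X → ℝ, IsGreenFunction μ γ s W G

/-! ### Dyadic systems -/

/-- The supremum of `r₁ / r₂` over all balls `B(x₁,r₁) ⊆ Q` and `B(x₂,r₂) ⊇ Q`. -/
def eccentricity (Q : Set X) : ℝ≥0∞ :=
  ⨆ (x₁ : X) (r₁ : ℝ) (x₂ : X) (r₂ : ℝ) (_ : 0 < r₁) (_ : 0 < r₂)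
    (_ : ball x₁ r₁ ⊆ Q) (_ : Q ⊆ ball x₂ r₂), ENNReal.ofReal (r₁ / r₂)

/-- The offspring of a cube `Q` of level `j`: the cubes of level `j + 1` contained in `Q`. -/
def offspring (D : ℤ → Set (Set X)) (j : ℤ) (Q : Set X) : Set (Set X) :=
  {Q' | Q' ∈ D (j + 1) ∧ Q' ⊆ Q}

/-- A (Christ) dyadic system on `X`; `D j` is the family of the cubes of level `j`.
The lower bound on the diameter excludes unbounded cubes, whose `Metric.diam` is `0`. -/
structure IsDyadicSystem (D : ℤ → Set (Set X)) : Prop where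
  metric_control : ∃ ν c C : ℝ, 0 < ν ∧ ν < 1 ∧ 0 < c ∧ 0 < C ∧ ∀ j, ∀ Q ∈ D j,
    c * ν ^ j ≤ diam Q ∧ diam Q ≤ C * ν ^ j ∧
    ENNReal.ofReal c ≤ eccentricity Q ∧ eccentricity Q ≤ ENNReal.ofReal C
  measurable : ∀ j, ∀ Q ∈ D j, MeasurableSet Q
  partition : ∀ j, Setoid.IsPartition (D j)
  parent : ∀ j, ∀ Q ∈ D (j + 1), ∃! P, P ∈ D j ∧ Q ⊆ P
  offspring_card : ∃ M : ℕ, ∀ j, ∀ Q ∈ D j,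
    1 ≤ (offspring D j Q).encard ∧ (offspring D j Q).encard ≤ M
  nested : ∀ i j, ∀ P ∈ D i, ∀ Q ∈ D j, P ∩ Q = ∅ ∨ P ⊆ Q ∨ Q ⊆ P
  quadrant : ∀ j, ∀ Q ∈ D j, ⋃₀ {P | (∃ i, P ∈ D i) ∧ Q ⊆ P} = univ

/-- The subspace of `L²` of the functions that are (almost everywhere) constant on each set of the
family `F`. -/
def constOn (μ : Measure X) (F : Set (Set X)) : Submodule ℝ (Lp ℝ 2 μ) where
  carrier := {f | ∀ Q ∈ F, ∃ c : ℝ, ∀ᵐ x ∂μ, x ∈ Q → f x = c}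
  zero_mem' := fun _ _ => ⟨0, by
    filter_upwards [Lp.coeFn_zero ℝ 2 μ] with x hx _
    simpa using hx⟩
  add_mem' := fun {f g} hf hg Q hQ => by
    obtain ⟨a, ha⟩ := hf Q hQ
    obtain ⟨b, hb⟩ := hg Q hQ
    refine ⟨a + b, ?_⟩
    filter_upwards [Lp.coeFn_add f g, ha, hb] with x hx h1 h2 hxQ
    rw [hx, Pi.add_apply, h1 hxQ, h2 hxQ]
  smul_mem' := fun t f hf Q hQ => by
    obtain ⟨a, ha⟩ := hf Q hQ
    refine ⟨t * a, ?_⟩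
    filter_upwards [Lp.coeFn_smul t f, ha] with x hx h1 hxQ
    rw [hx, Pi.smul_apply, h1 hxQ, smul_eq_mul]

/-- The subspace of `L²` of the functions that vanish (almost everywhere) outside `Q`. -/
def vanishOff (μ : Measure X) (Q : Set X) : Submodule ℝ (Lp ℝ 2 μ) where
  carrier := {f | ∀ᵐ x ∂μ, x ∉ Q → f x = 0}
  zero_mem' := by
    filter_upwards [Lp.coeFn_zero ℝ 2 μ] with x hx _
    simpa using hx
  add_mem' := fun {f g} hf hg => by
    change ∀ᵐ x ∂μ, x ∉ Q → (f + g : Lp ℝ 2 μ) x = 0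
    filter_upwards [Lp.coeFn_add f g, hf, hg] with x hx h1 h2 hxQ
    rw [hx, Pi.add_apply, h1 hxQ, h2 hxQ, add_zero]
  smul_mem' := fun t f hf => by
    change ∀ᵐ x ∂μ, x ∉ Q → (t • f : Lp ℝ 2 μ) x = 0
    filter_upwards [Lp.coeFn_smul t f, hf] with x hx h1 hxQ
    rw [hx, Pi.smul_apply, h1 hxQ, smul_zero]

/-- The orthogonal projector of `L²` onto the closure of `K`. -/
def projector {μ : Measure X} (K : Submodule ℝ (Lp ℝ 2 μ)) : Lp ℝ 2 μ →L[ℝ] Lp ℝ 2 μ :=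
  K.topologicalClosure.starProjection

/-- The orthogonal projector `P_j` onto the space `V_j` of the `L²` functions that are constant on
the cubes of level `j` (a closed space). -/
def levelProjector (μ : Measure X) (D : ℤ → Set (Set X)) (j : ℤ) : Lp ℝ 2 μ →L[ℝ] Lp ℝ 2 μ :=
  projector (constOn μ (D j))

/-- The functions that vanish off the cube `Q` of level `j` and are constant on its offspring. -/
def cubeSpace (μ : Measure X) (D : ℤ → Set (Set X)) (j : ℤ) (Q : Set X) :
    Submodule ℝ (Lp ℝ 2 μ) :=
  vanishOff μ Q ⊓ constOn μ (offspring D j Q)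

/-- A Haar system: for each cube `Q` of level `j`, a set `H j Q` which together with the
normalized indicator `e` of `Q` is an orthonormal basis of `cubeSpace μ D j Q`
(so `H j Q` is empty if `Q` has a single child). -/
def IsHaarSystem (μ : Measure X) (D : ℤ → Set (Set X)) (H : ℤ → Set X → Set (Lp ℝ 2 μ)) : Prop :=
  ∀ j, ∀ Q ∈ D j, ∃ e : Lp ℝ 2 μ,
    e =ᵐ[μ] Q.indicator (fun _ => 1 / √(μ.real Q)) ∧ e ∉ H j Q ∧
    Orthonormal ℝ ((↑) : (insert e (H j Q) : Set (Lp ℝ 2 μ)) → Lp ℝ 2 μ) ∧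
    Submodule.span ℝ (insert e (H j Q)) = cubeSpace μ D j Q

/-- The orthogonal projector `Π_t` onto the closed span `M_t` of the Haar functions whose cubes
have measure larger than `t`. -/
def haarProjector (μ : Measure X) (D : ℤ → Set (Set X)) (H : ℤ → Set X → Set (Lp ℝ 2 μ)) (t : ℝ) :
    Lp ℝ 2 μ →L[ℝ] Lp ℝ 2 μ :=
  projector (Submodule.span ℝ
    {h | ∃ j, ∃ Q ∈ D j, ENNReal.ofReal t < μ Q ∧ h ∈ H j Q})

/-- The space of the functions in `H^σ_{d,μ}` annihilated by `P_j`. -/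
def levelKernelSpace (μ : Measure X) (σ : ℝ) (D : ℤ → Set (Set X)) (j : ℤ) : Set (Lp ℝ 2 μ) :=
  {u | u ∈ sobolevSpace μ σ ∧ levelProjector μ D j u = 0}

/-- The space of the functions in `H^σ_{d,μ}` annihilated by `Π_t`. -/
def haarKernelSpace (μ : Measure X) (σ : ℝ) (D : ℤ → Set (Set X))
    (H : ℤ → Set X → Set (Lp ℝ 2 μ)) (t : ℝ) : Set (Lp ℝ 2 μ) :=
  {u | u ∈ sobolevSpace μ σ ∧ haarProjector μ D H t u = 0}

end

end FracGreen

/-!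
The energy of order `s/γ` is comparable with the square of the `L²(X × X)` norm of the difference
quotient `(u(x) - u(y)) / d(x,y)^(s + γ/2)` (`energy_comparable`), and the form `B` is the pullback
of the inner product of `L²(X × X)` under the linear map `diffQuotMap` that sends `u` to its
difference quotient. So the Green function at `x` is the Riesz representative of the evaluation
functional `v ↦ v(x)`, once this functional is bounded and the range of `diffQuotMap` on the space of
coercivity is closed.

Boundedness is an embedding of Morrey type (`AhlforsRegular.exists_continuous_rep`): averages of `u`
over comparable balls of radius `r` differ by `O(r^(s - γ/2))` times the square root of the energy,
so for `s > γ/2` the averages over `B(x, 2⁻ᵏ)` converge geometrically and uniformly, to a continuous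
function that equals `u` almost everywhere by Lebesgue differentiation. On a space of coercivity the
`L²` norm in the resulting bound is absorbed by the energy. The range is closed
(`IsCoercivitySpace.isClosed_range_diffQuotMap`) because the energy norm dominates the Sobolev norm
there and the graph of the difference quotient is closed.

For the dyadic spaces, coercivity follows from the Poincaré inequality for functions of mean zero,
summed over the cubes of one level (`IsDyadicSystem.exists_coercive`). Functions in the kernel of
`P_j` have mean zero on each cube of level `j`. For the kernel of `Π_t`, take a level so coarse that
all its cubes and their ancestors have measure larger than `t`. Orthogonality to the Haar functions
makes the mean of `u` over a cube of that level equal to its mean over each ancestor, and the latter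
is at most `‖u‖ / √(measure of the ancestor)`, which tends to zero
(`IsHaarSystem.setIntegral_eq_zero`).
-/

namespace FracGreen

open Filter Topology
open scoped RealInnerProductSpace NNReal

section

variable {X : Type*} [MetricSpace X]

/-! ### Consequences of Ahlfors regularity -/

section Ahlfors

variable [MeasurableSpace X] {μ : Measure X} {γ : ℝ}

theorem AhlforsRegular.measure_ball_lt_top (h : AhlforsRegular γ μ) (x : X) (r : ℝ) :
    μ (ball x r) < ∞ := by
  obtain ⟨c₁, c₂, -, -, h⟩ := h
  rcases le_or_gt r 0 with hr | hr
  · simp [ball_eq_empty.2 hr]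
  · exact (h x r hr).2.trans_lt ENNReal.ofReal_lt_top

theorem AhlforsRegular.measure_ball_pos (h : AhlforsRegular γ μ) (x : X) {r : ℝ} (hr : 0 < r) :
    0 < μ (ball x r) := by
  obtain ⟨c₁, c₂, h₁, -, h⟩ := h
  exact (ENNReal.ofReal_pos.2 (mul_pos h₁ (Real.rpow_pos_of_pos hr _))).trans_le (h x r hr).1

theorem AhlforsRegular.isLocallyFiniteMeasure (h : AhlforsRegular γ μ) :
    IsLocallyFiniteMeasure μ :=
  ⟨fun x => ⟨ball x 1, ball_mem_nhds x one_pos, h.measure_ball_lt_top x 1⟩⟩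

theorem AhlforsRegular.isOpenPosMeasure (h : AhlforsRegular γ μ) : μ.IsOpenPosMeasure := by
  refine ⟨fun U hU ⟨x, hx⟩ => ?_⟩
  obtain ⟨r, hr, hrU⟩ := Metric.isOpen_iff.1 hU x hx
  exact ((h.measure_ball_pos x hr).trans_le (measure_mono hrU)).ne'

theorem AhlforsRegular.sigmaFinite (h : AhlforsRegular γ μ) : SigmaFinite μ := by
  rcases isEmpty_or_nonempty X with hX | ⟨⟨x⟩⟩
  · rw [Measure.eq_zero_of_isEmpty μ]
    infer_instance
  · exact ⟨⟨⟨fun n => ball x n, fun _ => trivial, fun n => h.measure_ball_lt_top x n,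
      iUnion_ball_nat x⟩⟩⟩

/-- By the Vitali covering lemma some disjoint family of balls of radius `ε/4` has `ε`-dense centers.
Such a family is countable, because balls have positive measure and `μ` is `σ`-finite. -/
theorem AhlforsRegular.secondCountableTopology [BorelSpace X] (h : AhlforsRegular γ μ) :
    SecondCountableTopology X := by
  have := h.sigmaFinite
  refine secondCountable_of_almost_dense_set fun ε hε => ?_
  obtain ⟨u, -, hdisj, hcov⟩ := Vitali.exists_disjoint_subfamily_covering_enlargement_closedBall
    (univ : Set X) id (fun _ => ε / 4) (ε / 4) (fun _ _ => le_rfl) 4 (by norm_num)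
  refine ⟨u, ?_, fun x => ?_⟩
  · have hc : Set.Countable {i : u | 0 < μ (closedBall (i : X) (ε / 4))} :=
      Measure.countable_meas_pos_of_disjoint_iUnion (fun i => measurableSet_closedBall)
        (fun i j hij => hdisj i.2 j.2 (fun hh => hij (Subtype.ext hh)))
    have hall : {i : u | 0 < μ (closedBall (i : X) (ε / 4))} = univ :=
      eq_univ_of_forall fun i => (h.measure_ball_pos (i : X) (by positivity)).trans_le
        (measure_mono ball_subset_closedBall)
    rw [hall] at hc
    exact (Set.countable_coe_iff.1 (countable_univ_iff.1 hc))
  · obtain ⟨b, hb, hsub⟩ := hcov x (mem_univ x)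
    have : x ∈ closedBall (id b) (4 * (ε / 4)) := hsub (mem_closedBall_self (by positivity))
    exact ⟨b, hb, by simpa [mul_div_cancel₀] using this⟩

theorem AhlforsRegular.measure_closedBall_lt_top (h : AhlforsRegular γ μ) (x : X) (r : ℝ) :
    μ (closedBall x r) < ∞ :=
  (measure_mono (closedBall_subset_ball (lt_add_one r))).trans_lt (h.measure_ball_lt_top x _)

theorem AhlforsRegular.isUnifLocDoublingMeasure (hμ : AhlforsRegular γ μ) :
    IsUnifLocDoublingMeasure μ := by
  obtain ⟨c₁, c₂, h₁, h₂, h⟩ := hμ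
  refine ⟨⟨(c₂ * 3 ^ γ / c₁).toNNReal, ?_⟩⟩
  filter_upwards [self_mem_nhdsWithin] with ε hε x
  have hε : 0 < ε := hε
  calc μ (closedBall x (2 * ε)) ≤ μ (ball x (3 * ε)) :=
        measure_mono (closedBall_subset_ball (by linarith))
    _ ≤ ENNReal.ofReal (c₂ * (3 * ε) ^ γ) := (h x _ (by positivity)).2
    _ = ENNReal.ofReal (c₂ * 3 ^ γ / c₁) * ENNReal.ofReal (c₁ * ε ^ γ) := by
        rw [← ENNReal.ofReal_mul (by positivity), Real.mul_rpow (by norm_num) hε.le]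
        congr 1
        field_simp
    _ ≤ _ := by
        gcongr
        · exact le_rfl
        · exact (h x ε hε).1.trans (measure_mono ball_subset_closedBall)

end Ahlfors

/-! ### Weighted difference quotients and the energy -/

/-- The difference quotient `(u(x) - u(y)) / d(x,y)^(s + γ/2)`. Its square integral over `X × X` is
`B(u,u)`, and on an Ahlfors regular space it is comparable with the energy of order `s/γ`. -/
noncomputable def diffQuot (γ s : ℝ) (u : X → ℝ) (z : X × X) : ℝ :=
  (u z.1 - u z.2) / dist z.1 z.2 ^ (s + γ / 2)

theorem dirichletIntegrand_eq_mul (γ s : ℝ) (u v : X → ℝ) (z : X × X) :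
    dirichletIntegrand γ s u v z = diffQuot γ s u z * diffQuot γ s v z := by
  unfold dirichletIntegrand diffQuot
  rcases eq_or_ne z.1 z.2 with h | h
  · simp [h]
  · have hd : 0 < dist z.1 z.2 := dist_pos.2 h
    rw [Real.rpow_add hd]
    have h2 : dist z.1 z.2 ^ γ = dist z.1 z.2 ^ (γ / 2) * dist z.1 z.2 ^ (γ / 2) := by
      rw [← Real.rpow_add hd]; ring_nf
    rw [h2]
    have := (Real.rpow_pos_of_pos hd s).ne'
    have := (Real.rpow_pos_of_pos hd (γ / 2)).ne'
    field_simp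

theorem abs_sub_le_diffQuot {γ s R : ℝ} (u : X → ℝ) {z : X × X} (hs : 0 ≤ s + γ / 2)
    (hz : dist z.1 z.2 ≤ R) :
    |u z.1 - u z.2| ≤ R ^ (s + γ / 2) * |diffQuot γ s u z| := by
  have hR : 0 ≤ R := dist_nonneg.trans hz
  rcases eq_or_ne z.1 z.2 with h | h
  · rw [h]; simp only [sub_self, abs_zero]; positivity
  · have hd : 0 < dist z.1 z.2 ^ (s + γ / 2) := Real.rpow_pos_of_pos (dist_pos.2 h) _
    have he : |u z.1 - u z.2| = dist z.1 z.2 ^ (s + γ / 2) * |diffQuot γ s u z| := by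
      rw [diffQuot, abs_div, abs_of_pos hd, mul_div_cancel₀ _ hd.ne']
    rw [he]
    gcongr

theorem diffQuot_add (γ s : ℝ) (u v : X → ℝ) :
    diffQuot γ s (u + v) = diffQuot γ s u + diffQuot γ s v := by
  ext z; simp only [diffQuot, Pi.add_apply]; ring

theorem diffQuot_smul (γ s c : ℝ) (u : X → ℝ) :
    diffQuot γ s (c • u) = c • diffQuot γ s u := by
  ext z; simp only [diffQuot, Pi.smul_apply, smul_eq_mul]; ring

variable [MeasurableSpace X]

theorem measurable_weight [BorelSpace X] [SecondCountableTopology X] (p : ℝ) :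
    Measurable fun z : X × X => dist z.1 z.2 ^ p :=
  (continuous_dist.measurable).pow_const p

theorem aestronglyMeasurable_diffQuot [BorelSpace X] [SecondCountableTopology X] {μ : Measure X}
    [SFinite μ] (γ s : ℝ) {u : X → ℝ} (hu : AEStronglyMeasurable u μ) :
    AEStronglyMeasurable (diffQuot γ s u) (μ.prod μ) := by
  have h1 : AEStronglyMeasurable (fun z : X × X => u z.1) (μ.prod μ) :=
    hu.comp_quasiMeasurePreserving Measure.quasiMeasurePreserving_fst
  have h2 : AEStronglyMeasurable (fun z : X × X => u z.2) (μ.prod μ) :=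
    hu.comp_quasiMeasurePreserving Measure.quasiMeasurePreserving_snd
  exact ((h1.sub h2).aemeasurable.div
    (measurable_weight (s + γ / 2)).aemeasurable).aestronglyMeasurable

theorem diffQuot_congr_ae {μ : Measure X} [SFinite μ] (γ s : ℝ) {u v : X → ℝ} (h : u =ᵐ[μ] v) :
    diffQuot γ s u =ᵐ[μ.prod μ] diffQuot γ s v := by
  have h1 : ∀ᵐ z ∂(μ.prod μ), u z.1 = v z.1 := Measure.quasiMeasurePreserving_fst.ae h
  have h2 : ∀ᵐ z ∂(μ.prod μ), u z.2 = v z.2 := Measure.quasiMeasurePreserving_snd.ae h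
  filter_upwards [h1, h2] with z hz1 hz2
  simp only [diffQuot, hz1, hz2]

theorem lintegral_enorm_sq_eq_eLpNorm_sq {Y : Type*} [MeasurableSpace Y] (ν : Measure Y)
    (f : Y → ℝ) : ∫⁻ y, ‖f y‖ₑ ^ 2 ∂ν = eLpNorm f 2 ν ^ 2 := by
  have := eLpNorm_nnreal_pow_eq_lintegral (μ := ν) (f := f) (p := 2) (by norm_num)
  simpa using this.symm

/-- On an Ahlfors regular space the energy of order `s/γ` is comparable with the square of the
`L²(X × X)` norm of the difference quotient. -/
theorem energy_comparable [BorelSpace X] {μ : Measure X} {γ s : ℝ} (hγ : 0 < γ) (hs : 0 < s)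
    (hμ : AhlforsRegular γ μ) :
    ∃ a b : ℝ, 0 < a ∧ 0 < b ∧ ∀ u : X → ℝ,
      ENNReal.ofReal a * eLpNorm (diffQuot γ s u) 2 (μ.prod μ) ^ 2 ≤ energy μ (s / γ) u ∧
      energy μ (s / γ) u ≤ ENNReal.ofReal b * eLpNorm (diffQuot γ s u) 2 (μ.prod μ) ^ 2 := by
  obtain ⟨c₁, c₂, h₁, h₂, h⟩ := hμ
  have hp : 0 < 1 + 2 * (s / γ) := by positivity
  set p := 1 + 2 * (s / γ) with hpdef
  have key : ∀ c : ℝ, 0 < c → ∀ (u : X → ℝ) (z : X × X),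
      ENNReal.ofReal ((c ^ p)⁻¹) * ‖diffQuot γ s u z‖ₑ ^ 2 =
        ENNReal.ofReal ((u z.1 - u z.2) ^ 2) /
          (ENNReal.ofReal (c * dist z.1 z.2 ^ γ)) ^ p := by
    intro c hc u z
    rcases eq_or_ne z.1 z.2 with hz | hz
    · simp [diffQuot, hz]
    · have hd : 0 < dist z.1 z.2 := dist_pos.2 hz
      rw [ENNReal.ofReal_rpow_of_pos (by positivity), ← ENNReal.ofReal_div_of_pos (by positivity),
        Real.enorm_eq_ofReal_abs, ← ENNReal.ofReal_pow (abs_nonneg _), sq_abs,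
        ← ENNReal.ofReal_mul (by positivity)]
      congr 1
      have e : (dist z.1 z.2 ^ γ) ^ p = (dist z.1 z.2 ^ (s + γ / 2)) ^ 2 := by
        rw [← Real.rpow_mul hd.le, ← Real.rpow_natCast, ← Real.rpow_mul hd.le]
        congr 1
        rw [hpdef]
        push_cast
        field_simp
        ring
      rw [Real.mul_rpow hc.le (by positivity), e, diffQuot]
      field_simp
  refine ⟨(c₂ ^ p)⁻¹, (c₁ ^ p)⁻¹, by positivity, by positivity, fun u => ⟨?_, ?_⟩⟩
  · rw [← lintegral_enorm_sq_eq_eLpNorm_sq, ← lintegral_const_mul' _ _ ENNReal.ofReal_ne_top]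
    refine lintegral_mono fun z => ?_
    rw [key c₂ h₂ u z]
    rcases eq_or_ne z.1 z.2 with hz | hz
    · simp [hz]
    · exact ENNReal.div_le_div_left
        (ENNReal.rpow_le_rpow (h z.1 _ (dist_pos.2 hz)).2 hp.le) _
  · rw [← lintegral_enorm_sq_eq_eLpNorm_sq, ← lintegral_const_mul' _ _ ENNReal.ofReal_ne_top]
    refine lintegral_mono fun z => ?_
    rw [key c₁ h₁ u z]
    rcases eq_or_ne z.1 z.2 with hz | hz
    · simp [hz]
    · exact ENNReal.div_le_div_left
        (ENNReal.rpow_le_rpow (h z.1 _ (dist_pos.2 hz)).1 hp.le) _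

theorem mem_sobolevSpace_iff [BorelSpace X] [SecondCountableTopology X] {μ : Measure X}
    [SFinite μ] {γ s : ℝ} (hγ : 0 < γ) (hs : 0 < s) (hμ : AhlforsRegular γ μ) (u : Lp ℝ 2 μ) :
    u ∈ sobolevSpace μ (s / γ) ↔ MemLp (diffQuot γ s u) 2 (μ.prod μ) := by
  obtain ⟨a, b, ha, hb, h⟩ := energy_comparable hγ hs hμ
  constructor
  · intro hu
    refine ⟨aestronglyMeasurable_diffQuot γ s (Lp.aestronglyMeasurable u), ?_⟩
    by_contra hcon
    have htop : eLpNorm (diffQuot γ s u) 2 (μ.prod μ) = ∞ := not_lt_top_iff.1 hcon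
    have := (h u).1
    rw [htop, ENNReal.top_pow two_ne_zero,
      ENNReal.mul_top (ENNReal.ofReal_pos.2 ha).ne'] at this
    exact absurd (this.trans_lt hu) (lt_irrefl _)
  · intro hu
    exact (h u).2.trans_lt (ENNReal.mul_lt_top ENNReal.ofReal_lt_top
      (ENNReal.pow_lt_top hu.2))

end

section

/-! ### Averages over balls and continuous representatives -/

theorem setIntegral_norm_le_sqrt_mul {Y : Type*} [MeasurableSpace Y] {ν : Measure Y} {f : Y → ℝ}
    (hf : MemLp f 2 ν) {A : Set Y} (hA : MeasurableSet A) (hνA : ν A ≠ ∞) :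
    ∫ y in A, ‖f y‖ ∂ν ≤ √(ν.real A) * (eLpNorm f 2 ν).toReal := by
  have h1 : ∫ y in A, ‖f y‖ ∂ν = ⟪indicatorConstLp 2 hA hνA (1 : ℝ), hf.norm.toLp⟫ := by
    rw [L2.inner_indicatorConstLp_one]
    exact integral_congr_ae (ae_restrict_of_ae (by
      filter_upwards [hf.norm.coeFn_toLp] with y hy using hy.symm))
  rw [h1]
  refine (real_inner_le_norm _ _).trans (le_of_eq ?_)
  rw [norm_indicatorConstLp (by norm_num) (by norm_num), Lp.norm_toLp, eLpNorm_norm]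
  simp [Real.sqrt_eq_rpow]

theorem integrableOn_of_memLp_two {Y : Type*} [MeasurableSpace Y] {ν : Measure Y} {f : Y → ℝ}
    (hf : MemLp f 2 ν) {A : Set Y} (hνA : ν A ≠ ∞) : IntegrableOn f A ν := by
  have : IsFiniteMeasure (ν.restrict A) := ⟨by simpa using hνA.lt_top⟩
  exact (hf.restrict A).integrable (by norm_num)

variable {X : Type*} [MetricSpace X] [MeasurableSpace X]

/-- The averages over two sets `A`, `A'` at mutual distance at most `R` differ by at most
`R^(s + γ/2) / √(μ(A) μ(A'))` times the `L²` norm of the difference quotient: the difference of the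
averages is the average of `u(x) - u(y)` over `A × A'`. -/
theorem abs_average_sub_average_le {μ : Measure X} [SFinite μ] {γ s R : ℝ} (hs : 0 ≤ s + γ / 2)
    {u : X → ℝ} (hu : MemLp u 2 μ) (hq : MemLp (diffQuot γ s u) 2 (μ.prod μ)) {A A' : Set X}
    (hA : MeasurableSet A) (hA' : MeasurableSet A') (hμA : μ A ≠ ∞) (hμA' : μ A' ≠ ∞)
    (h0 : 0 < μ.real A) (h0' : 0 < μ.real A') (hR : ∀ x ∈ A, ∀ y ∈ A', dist x y ≤ R) :
    |(⨍ x in A, u x ∂μ) - ⨍ y in A', u y ∂μ| ≤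
      R ^ (s + γ / 2) / √(μ.real A * μ.real A') *
        (eLpNorm (diffQuot γ s u) 2 (μ.prod μ)).toReal := by
  have iA := integrableOn_of_memLp_two hu hμA
  have iA' := integrableOn_of_memLp_two hu hμA'
  have fA : IsFiniteMeasure (μ.restrict A) := ⟨by simpa using hμA.lt_top⟩
  have fA' : IsFiniteMeasure (μ.restrict A') := ⟨by simpa using hμA'.lt_top⟩
  have hprod : (μ.prod μ) (A ×ˢ A') ≠ ∞ := by
    rw [Measure.prod_prod]; exact ENNReal.mul_ne_top hμA hμA'
  have hprodr : (μ.prod μ).real (A ×ˢ A') = μ.real A * μ.real A' := by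
    rw [measureReal_def, Measure.prod_prod, ENNReal.toReal_mul]; rfl
  set m := μ.real A * μ.real A' with hm
  have hmpos : 0 < m := mul_pos h0 h0'
  have e : (⨍ x in A, u x ∂μ) - ⨍ y in A', u y ∂μ =
      m⁻¹ * ∫ z in A ×ˢ A', (u z.1 - u z.2) ∂(μ.prod μ) := by
    rw [← Measure.prod_restrict, integral_sub (iA.comp_fst _) (iA'.comp_snd _),
      integral_fun_fst, integral_fun_snd, setAverage_eq, setAverage_eq]
    simp only [measureReal_restrict_apply_univ, smul_eq_mul]
    rw [hm]
    field_simp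
  have hbound : |∫ z in A ×ˢ A', (u z.1 - u z.2) ∂(μ.prod μ)| ≤
      R ^ (s + γ / 2) * ∫ z in A ×ˢ A', ‖diffQuot γ s u z‖ ∂(μ.prod μ) := by
    rw [← integral_const_mul, ← Real.norm_eq_abs]
    refine norm_integral_le_of_norm_le
      ((integrableOn_of_memLp_two hq hprod).norm.const_mul _) ?_
    filter_upwards [ae_restrict_mem (hA.prod hA')] with z hz
    exact abs_sub_le_diffQuot u hs (hR _ hz.1 _ hz.2)
  have hRn : 0 ≤ R := by
    have h1 : A.Nonempty := nonempty_iff_ne_empty.2 fun h => by simp [h] at h0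
    have h2 : A'.Nonempty := nonempty_iff_ne_empty.2 fun h => by simp [h] at h0'
    obtain ⟨x, hx⟩ := h1
    obtain ⟨y, hy⟩ := h2
    exact dist_nonneg.trans (hR x hx y hy)
  have hcs := setIntegral_norm_le_sqrt_mul hq (hA.prod hA') hprod
  rw [hprodr] at hcs
  set q := (eLpNorm (diffQuot γ s u) 2 (μ.prod μ)).toReal
  rw [e, abs_mul, abs_of_pos (inv_pos.2 hmpos)]
  calc m⁻¹ * |∫ z in A ×ˢ A', (u z.1 - u z.2) ∂(μ.prod μ)|
      ≤ m⁻¹ * (R ^ (s + γ / 2) * (√m * q)) := by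
        gcongr
        exact hbound.trans (by gcongr)
    _ = R ^ (s + γ / 2) / √m * q := by
        have : m⁻¹ = (√m)⁻¹ * (√m)⁻¹ := by
          rw [← mul_inv, Real.mul_self_sqrt hmpos.le]
        rw [this]
        have := (Real.sqrt_pos.2 hmpos).ne'
        field_simp

theorem AhlforsRegular.exists_le_measureReal_closedBall {μ : Measure X} {γ : ℝ}
    (hμ : AhlforsRegular γ μ) :
    ∃ c : ℝ, 0 < c ∧ ∀ (x : X) (r : ℝ), 0 < r → c * r ^ γ ≤ μ.real (ball x r) ∧
      c * r ^ γ ≤ μ.real (closedBall x r) := by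
  have hb := hμ.measure_ball_lt_top
  have hcb := hμ.measure_closedBall_lt_top
  obtain ⟨c₁, c₂, h₁, h₂, h⟩ := hμ
  refine ⟨c₁, h₁, fun x r hr => ⟨?_, ?_⟩⟩
  · exact (ENNReal.ofReal_le_iff_le_toReal (hb x r).ne).1 (h x r hr).1
  · exact (ENNReal.ofReal_le_iff_le_toReal (hcb x r).ne).1
      ((h x r hr).1.trans (measure_mono ball_subset_closedBall))

theorem AhlforsRegular.exists_abs_average_sub_average_le [BorelSpace X] {μ : Measure X}
    [SFinite μ] {γ s : ℝ} (hγ : 0 < γ) (hs : 0 < s) (hμ : AhlforsRegular γ μ) :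
    ∃ M : ℝ, 0 < M ∧ ∀ u : X → ℝ, MemLp u 2 μ → MemLp (diffQuot γ s u) 2 (μ.prod μ) →
      ∀ (x y : X) (r r' : ℝ), 0 < r → dist x y ≤ r → r / 2 ≤ r' → r' ≤ r →
        |(⨍ p in closedBall x r, u p ∂μ) - ⨍ p in closedBall y r', u p ∂μ| ≤
          M * r ^ (s - γ / 2) * (eLpNorm (diffQuot γ s u) 2 (μ.prod μ)).toReal := by
  obtain ⟨c, hc, hlow⟩ := hμ.exists_le_measureReal_closedBall
  refine ⟨3 ^ (s + γ / 2) / (c * (1 / 2) ^ γ), by positivity,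
    fun u hu hq x y r r' hr hxy h1 h2 => ?_⟩
  have hr' : 0 < r' := by linarith
  have l1 : c * (r / 2) ^ γ ≤ μ.real (closedBall x r) :=
    le_trans (by gcongr; linarith) (hlow x r hr).2
  have l2 : c * (r / 2) ^ γ ≤ μ.real (closedBall y r') :=
    le_trans (by gcongr) (hlow y r' hr').2
  have hpos : 0 < c * (r / 2) ^ γ := by positivity
  refine (abs_average_sub_average_le (R := 3 * r) (by positivity) hu hq measurableSet_closedBall
    measurableSet_closedBall (hμ.measure_closedBall_lt_top _ _).ne
    (hμ.measure_closedBall_lt_top _ _).ne (hpos.trans_le l1) (hpos.trans_le l2) ?_).trans ?_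
  · intro p hp p' hp'
    have := dist_triangle4 p x y p'
    rw [mem_closedBall] at hp hp'
    rw [dist_comm] at hp'
    linarith
  · refine mul_le_mul_of_nonneg_right ?_ ENNReal.toReal_nonneg
    have hsq : c * (r / 2) ^ γ ≤ √(μ.real (closedBall x r) * μ.real (closedBall y r')) := by
      refine Real.le_sqrt_of_sq_le ?_
      rw [sq]
      exact mul_le_mul l1 l2 hpos.le (hpos.le.trans l1)
    calc (3 * r) ^ (s + γ / 2) / √(μ.real (closedBall x r) * μ.real (closedBall y r'))
        ≤ (3 * r) ^ (s + γ / 2) / (c * (r / 2) ^ γ) := by gcongr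
      _ = 3 ^ (s + γ / 2) / (c * (1 / 2) ^ γ) * r ^ (s - γ / 2) := by
        have e1 : r ^ (s + γ / 2) = r ^ (s - γ / 2) * r ^ γ := by
          rw [← Real.rpow_add hr]; ring_nf
        rw [Real.mul_rpow (by norm_num) hr.le, e1, div_eq_mul_one_div r 2,
          Real.mul_rpow hr.le (by norm_num)]
        have := (Real.rpow_pos_of_pos hr γ).ne'
        field_simp

/-- For `s > γ/2` a function of finite energy has a continuous representative `v`, whose values are
controlled by the `L²` norm and the energy. The representative is the limit of the averages over
the balls `B(x, 2⁻ᵏ)`, which converge geometrically with ratio `2^(γ/2 - s) < 1`. -/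
theorem AhlforsRegular.exists_continuous_rep [BorelSpace X] [SecondCountableTopology X]
    {μ : Measure X} [SFinite μ] {γ s : ℝ} (hγ : 0 < γ) (hs : γ / 2 < s)
    (hμ : AhlforsRegular γ μ) :
    ∃ C : ℝ, 0 < C ∧ ∀ u : X → ℝ, MemLp u 2 μ → MemLp (diffQuot γ s u) 2 (μ.prod μ) →
      ∃ v : X → ℝ, Continuous v ∧ v =ᵐ[μ] u ∧ ∀ x, |v x| ≤
        C * ((eLpNorm u 2 μ).toReal + (eLpNorm (diffQuot γ s u) 2 (μ.prod μ)).toReal) := by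
  obtain ⟨M, hM, hav⟩ := hμ.exists_abs_average_sub_average_le hγ (by linarith : 0 < s)
  obtain ⟨c, hc, hlow⟩ := hμ.exists_le_measureReal_closedBall
  have := hμ.isLocallyFiniteMeasure
  have := hμ.isUnifLocDoublingMeasure
  set ρ : ℝ := (1 / 2) ^ (s - γ / 2) with hρ
  have hρ0 : 0 < ρ := by positivity
  have hρ1 : ρ < 1 := Real.rpow_lt_one (by norm_num) (by norm_num) (by linarith)
  have hρpow : ∀ k : ℕ, ((1 / 2 : ℝ) ^ k) ^ (s - γ / 2) = ρ ^ k := fun k => by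
    rw [hρ, ← Real.rpow_natCast, ← Real.rpow_natCast, ← Real.rpow_mul (by norm_num),
      ← Real.rpow_mul (by norm_num), mul_comm]
  refine ⟨(√c)⁻¹ + M / (1 - ρ), by have : 0 < 1 - ρ := by linarith
                                   positivity, fun u hu hq => ?_⟩
  set q := (eLpNorm (diffQuot γ s u) 2 (μ.prod μ)).toReal with hqdef
  set A : X → ℕ → ℝ := fun x k => ⨍ p in closedBall x ((1 / 2) ^ k), u p ∂μ with hA
  have hstep : ∀ x k, dist (A x k) (A x (k + 1)) ≤ M * q * ρ ^ k := fun x k => by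
    have := hav u hu hq x x ((1 / 2) ^ k) ((1 / 2) ^ (k + 1)) (by positivity)
      (by rw [dist_self]; positivity) (by rw [pow_succ]; linarith)
      (pow_le_pow_of_le_one (by norm_num) (by norm_num) (Nat.le_succ k))
    rw [hρpow] at this
    rw [Real.dist_eq]
    linarith
  have hlim : ∀ x, ∃ l, Tendsto (A x) atTop (𝓝 l) := fun x =>
    cauchySeq_tendsto_of_complete (cauchySeq_of_le_geometric ρ (M * q) hρ1 (hstep x))
  choose v hv using hlim
  have hdist : ∀ x k, dist (A x k) (v x) ≤ M * q * ρ ^ k / (1 - ρ) := fun x k =>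
    dist_le_of_le_geometric_of_tendsto ρ (M * q) hρ1 (hstep x) (hv x) k
  have hq0 : 0 ≤ q := ENNReal.toReal_nonneg
  refine ⟨v, ?_, ?_, fun x => ?_⟩
  · rw [Metric.continuous_iff]
    intro x ε hε
    have ht : Tendsto (fun k => 2 * (M * q * ρ ^ k / (1 - ρ)) + M * q * ρ ^ k) atTop (𝓝 0) := by
      have h0 := tendsto_pow_atTop_nhds_zero_of_lt_one hρ0.le hρ1
      have h1 := ((h0.const_mul (M * q)).div_const (1 - ρ)).const_mul 2
      simpa using h1.add (h0.const_mul (M * q))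
    obtain ⟨k, hk⟩ := ((tendsto_order.1 ht).2 ε hε).exists
    refine ⟨(1 / 2) ^ k, by positivity, fun y hy => ?_⟩
    have h1 := hav u hu hq y x ((1 / 2) ^ k) ((1 / 2) ^ k) (by positivity) hy.le
      (by have : (0 : ℝ) < (1 / 2) ^ k := by positivity
          linarith) le_rfl
    rw [hρpow, ← Real.dist_eq] at h1
    have h2 := dist_triangle4 (v y) (A y k) (A x k) (v x)
    have h3 := hdist x k
    have h4 := hdist y k
    rw [dist_comm] at h4
    have h5 : M * ρ ^ k * q = M * q * ρ ^ k := by ring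
    change dist (A y k) (A x k) ≤ M * ρ ^ k * q at h1
    linarith
  · filter_upwards [IsUnifLocDoublingMeasure.ae_tendsto_average μ
      (hu.locallyIntegrable (by norm_num)) 1] with x hx
    refine tendsto_nhds_unique (hv x) (hx (fun _ => x) (fun k : ℕ => (1 / 2 : ℝ) ^ k) ?_ ?_)
    · exact tendsto_nhdsWithin_iff.2 ⟨tendsto_pow_atTop_nhds_zero_of_lt_one (by norm_num)
        (by norm_num), Eventually.of_forall fun k => by simp⟩
    · exact Eventually.of_forall fun k => mem_closedBall_self (by positivity)
  · have h1 := hdist x 0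
    have hcb : c ≤ μ.real (closedBall x 1) := by simpa using (hlow x 1 one_pos).2
    have hpos := hc.trans_le hcb
    -- The average over `B(x, 1)` is bounded by the `L²` norm, by Cauchy-Schwarz.
    have h2 : |A x 0| ≤ (√c)⁻¹ * (eLpNorm u 2 μ).toReal := by
      simp only [hA, pow_zero, setAverage_eq, smul_eq_mul]
      rw [abs_mul, abs_of_pos (inv_pos.2 hpos)]
      calc (μ.real (closedBall x 1))⁻¹ * |∫ p in closedBall x 1, u p ∂μ|
          ≤ (μ.real (closedBall x 1))⁻¹ *
            (√(μ.real (closedBall x 1)) * (eLpNorm u 2 μ).toReal) := by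
            gcongr
            exact (norm_integral_le_integral_norm _).trans (setIntegral_norm_le_sqrt_mul hu
              measurableSet_closedBall (hμ.measure_closedBall_lt_top _ _).ne)
        _ = (√(μ.real (closedBall x 1)))⁻¹ * (eLpNorm u 2 μ).toReal := by
            rw [← mul_assoc]
            congr 1
            rw [← Real.sqrt_div_self, div_eq_inv_mul]
        _ ≤ _ := by gcongr
    rw [Real.dist_eq, pow_zero, mul_one] at h1
    have h3 : |v x| ≤ |A x 0| + |A x 0 - v x| := by
      have := abs_sub_abs_le_abs_sub (v x) (A x 0)
      rw [abs_sub_comm] at this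
      linarith
    have h4 : M * q / (1 - ρ) = M / (1 - ρ) * q := by ring
    have h5 : 0 ≤ (√c)⁻¹ * q := by positivity
    have h6 : 0 ≤ M / (1 - ρ) * (eLpNorm u 2 μ).toReal := by
      have : 0 < 1 - ρ := by linarith
      positivity
    nlinarith

end

section

/-! ### Riesz representation through the difference quotient -/

/-- Riesz representation for the inner product that an injective linear map `T` with closed range
in a Hilbert space induces on its domain. -/
theorem exists_forall_inner_map_eq {S F : Type*} [AddCommGroup S] [Module ℝ S]
    [NormedAddCommGroup F] [InnerProductSpace ℝ F] [CompleteSpace F] (T : S →ₗ[ℝ] F)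
    (hT : Function.Injective T) (hcl : IsClosed (T.range : Set F)) (φ : S →ₗ[ℝ] ℝ) (C : ℝ)
    (hφ : ∀ u, |φ u| ≤ C * ‖T u‖) : ∃ g : S, ∀ v, ⟪T g, T v⟫ = φ v := by
  have : CompleteSpace T.range := hcl.completeSpace_coe
  set e := LinearEquiv.ofInjective T hT with he
  have hsymm : ∀ y : T.range, T (e.symm y) = y := fun y =>
    congrArg Subtype.val (e.apply_symm_apply y)
  set ψ : StrongDual ℝ T.range := (φ.comp e.symm.toLinearMap).mkContinuous C fun y => by
    have := hφ (e.symm y)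
    rw [hsymm] at this
    simpa using this
  set k := (InnerProductSpace.toDual ℝ T.range).symm ψ with hk
  refine ⟨e.symm k, fun v => ?_⟩
  have h1 : ⟪k, e v⟫ = ψ (e v) := by
    rw [hk, InnerProductSpace.toDual_symm_apply]
  have h2 : ψ (e v) = φ v := by simp [ψ]
  rw [hsymm, ← h2, ← h1]
  rfl

variable {X : Type*} [MetricSpace X] [MeasurableSpace X]

theorem diffQuot_coeFn_add {μ : Measure X} [SFinite μ] (γ s : ℝ) (u v : Lp ℝ 2 μ) :
    diffQuot γ s (u + v : Lp ℝ 2 μ) =ᵐ[μ.prod μ] diffQuot γ s u + diffQuot γ s v := by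
  rw [← diffQuot_add]
  exact diffQuot_congr_ae γ s (Lp.coeFn_add u v)

theorem diffQuot_coeFn_smul {μ : Measure X} [SFinite μ] (γ s c : ℝ) (u : Lp ℝ 2 μ) :
    diffQuot γ s (c • u : Lp ℝ 2 μ) =ᵐ[μ.prod μ] c • diffQuot γ s u := by
  rw [← diffQuot_smul]
  exact diffQuot_congr_ae γ s (Lp.coeFn_smul c u)

theorem diffQuot_coeFn_sub {μ : Measure X} [SFinite μ] (γ s : ℝ) (u v : Lp ℝ 2 μ) :
    diffQuot γ s (u - v : Lp ℝ 2 μ) =ᵐ[μ.prod μ] diffQuot γ s u - diffQuot γ s v := by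
  refine (diffQuot_congr_ae γ s (Lp.coeFn_sub u v)).trans (Eventually.of_forall fun z => ?_)
  simp only [diffQuot, Pi.sub_apply]
  ring

/-- The difference quotient as a linear map from a space of functions of finite energy to
`L²(X × X)`. The form `B` is the pullback of the inner product under this map. -/
noncomputable def diffQuotMap {μ : Measure X} [SFinite μ] (γ s : ℝ) (S : Submodule ℝ (Lp ℝ 2 μ))
    (hS : ∀ u ∈ S, MemLp (diffQuot γ s u) 2 (μ.prod μ)) : S →ₗ[ℝ] Lp ℝ 2 (μ.prod μ) where
  toFun u := MemLp.toLp (diffQuot γ s (u : Lp ℝ 2 μ)) (hS u u.2)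
  map_add' u v := by
    rw [← MemLp.toLp_add (hS u u.2) (hS v v.2)]
    exact MemLp.toLp_congr _ _ (diffQuot_coeFn_add γ s (u : Lp ℝ 2 μ) v)
  map_smul' c u := by
    rw [RingHom.id_apply, ← MemLp.toLp_const_smul c (hS u u.2)]
    exact MemLp.toLp_congr _ _ (diffQuot_coeFn_smul γ s c (u : Lp ℝ 2 μ))

theorem coeFn_diffQuotMap {μ : Measure X} [SFinite μ] {γ s : ℝ} {S : Submodule ℝ (Lp ℝ 2 μ)}
    (hS : ∀ u ∈ S, MemLp (diffQuot γ s u) 2 (μ.prod μ)) (u : S) :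
    diffQuotMap γ s S hS u =ᵐ[μ.prod μ] diffQuot γ s u :=
  MemLp.coeFn_toLp (hS u u.2)

theorem norm_diffQuotMap {μ : Measure X} [SFinite μ] {γ s : ℝ} {S : Submodule ℝ (Lp ℝ 2 μ)}
    (hS : ∀ u ∈ S, MemLp (diffQuot γ s u) 2 (μ.prod μ)) (u : S) :
    ‖diffQuotMap γ s S hS u‖ = (eLpNorm (diffQuot γ s u) 2 (μ.prod μ)).toReal :=
  Lp.norm_toLp _ (hS u u.2)

theorem inner_diffQuotMap {μ : Measure X} [SFinite μ] {γ s : ℝ} {S : Submodule ℝ (Lp ℝ 2 μ)}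
    (hS : ∀ u ∈ S, MemLp (diffQuot γ s u) 2 (μ.prod μ)) (u v : S) :
    ⟪diffQuotMap γ s S hS u, diffQuotMap γ s S hS v⟫ = dirichletForm μ γ s u v := by
  rw [L2.inner_def, dirichletForm]
  refine integral_congr_ae ?_
  filter_upwards [coeFn_diffQuotMap hS u, coeFn_diffQuotMap hS v] with z h1 h2
  rw [h1, h2, dirichletIntegrand_eq_mul]
  simp [mul_comm]

/-- The graph of the difference quotient is closed: pass to a subsequence converging almost
everywhere. -/
theorem ae_eq_diffQuot_of_tendsto {μ : Measure X} [SFinite μ] {γ s : ℝ} {w : ℕ → Lp ℝ 2 μ}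
    {u : Lp ℝ 2 μ} {W : ℕ → Lp ℝ 2 (μ.prod μ)} {h : Lp ℝ 2 (μ.prod μ)}
    (hW : ∀ n, W n =ᵐ[μ.prod μ] diffQuot γ s (w n)) (hw : Tendsto w atTop (𝓝 u))
    (hWh : Tendsto W atTop (𝓝 h)) : h =ᵐ[μ.prod μ] diffQuot γ s u := by
  obtain ⟨φ, hφ, hφu⟩ := (tendstoInMeasure_of_tendsto_Lp hw).exists_seq_tendsto_ae
  obtain ⟨ψ, hψ, hψh⟩ := (tendstoInMeasure_of_tendsto_Lp
    (hWh.comp hφ.tendsto_atTop)).exists_seq_tendsto_ae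
  have h1 : ∀ᵐ z ∂(μ.prod μ), Tendsto (fun i => w (φ i) z.1) atTop (𝓝 (u z.1)) :=
    Measure.quasiMeasurePreserving_fst.ae hφu
  have h2 : ∀ᵐ z ∂(μ.prod μ), Tendsto (fun i => w (φ i) z.2) atTop (𝓝 (u z.2)) :=
    Measure.quasiMeasurePreserving_snd.ae hφu
  filter_upwards [h1, h2, hψh, ae_all_iff.2 hW] with z z1 z2 z3 z4
  refine tendsto_nhds_unique z3 ?_
  simp only [Function.comp_apply, z4]
  exact (((z1.sub z2).div_const _).comp hψ.tendsto_atTop)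

section Coercivity

variable [BorelSpace X] {μ : Measure X} [SFinite μ] {γ s : ℝ}
  {S : Submodule ℝ (Lp ℝ 2 μ)}

theorem IsCoercivitySpace.exists_norm_le (hγ : 0 < γ) (hs : 0 < s) (hμ : AhlforsRegular γ μ)
    (hW : IsCoercivitySpace μ (s / γ) (S : Set (Lp ℝ 2 μ)))
    (hS : ∀ u ∈ S, MemLp (diffQuot γ s u) 2 (μ.prod μ)) :
    ∃ C : ℝ, 0 < C ∧ ∀ u : S, ‖u‖ ≤ C * ‖diffQuotMap γ s S hS u‖ := by
  obtain ⟨a, b, -, hb, hab⟩ := energy_comparable hγ hs hμ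
  obtain ⟨c, hc, hcoer⟩ := hW.coercive
  refine ⟨√(b / c), by positivity, fun u => ?_⟩
  have h1 := (hcoer u u.2).trans (hab u).2
  rw [norm_diffQuotMap hS]
  set q := eLpNorm (diffQuot γ s u) 2 (μ.prod μ) with hq
  have hqtop : q ≠ ∞ := (hS u u.2).2.ne
  rw [← ENNReal.ofReal_toReal hqtop, ← ofReal_norm, ← ENNReal.ofReal_pow (norm_nonneg _),
    ← ENNReal.ofReal_pow ENNReal.toReal_nonneg, ← ENNReal.ofReal_mul hc.le,
    ← ENNReal.ofReal_mul hb.le, ENNReal.ofReal_le_ofReal_iff (by positivity)] at h1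
  refine abs_le_of_sq_le_sq' ?_ (by positivity) |>.2
  rw [mul_pow, Real.sq_sqrt (by positivity), div_mul_eq_mul_div, le_div_iff₀ hc]
  rw [Submodule.coe_norm]
  linarith

/-- If the difference quotients of `w n` converge, then by coercivity `w n` converges in `L²`, hence
in the Sobolev norm since the graph of the difference quotient is closed, and the limit stays in the
space because the latter is closed. -/
theorem IsCoercivitySpace.isClosed_range_diffQuotMap [SecondCountableTopology X] (hγ : 0 < γ)
    (hs : 0 < s) (hμ : AhlforsRegular γ μ)
    (hW : IsCoercivitySpace μ (s / γ) (S : Set (Lp ℝ 2 μ)))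
    (hS : ∀ u ∈ S, MemLp (diffQuot γ s u) 2 (μ.prod μ)) :
    IsClosed ((diffQuotMap γ s S hS).range : Set (Lp ℝ 2 (μ.prod μ))) := by
  obtain ⟨C, hC, hbd⟩ := hW.exists_norm_le hγ hs hμ hS
  obtain ⟨a, b, -, hb, hab⟩ := energy_comparable hγ hs hμ
  refine IsSeqClosed.isClosed fun y h hy hyh => ?_
  choose w hw using hy
  obtain rfl : (fun n => diffQuotMap γ s S hS (w n)) = y := funext hw
  have hcau : CauchySeq fun n => (w n : Lp ℝ 2 μ) := by
    refine Metric.cauchySeq_iff'.2 fun ε hε => ?_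
    obtain ⟨N, hN⟩ := Metric.cauchySeq_iff'.1 hyh.cauchySeq (ε / C) (by positivity)
    refine ⟨N, fun n hn => ?_⟩
    have h1 := hbd (w n - w N)
    have h2 := hN n hn
    rw [dist_eq_norm, ← map_sub, lt_div_iff₀' hC] at h2
    rw [dist_eq_norm]
    exact h1.trans_lt h2
  obtain ⟨u, hu⟩ := cauchySeq_tendsto_of_complete hcau
  have hhu : h =ᵐ[μ.prod μ] diffQuot γ s u :=
    ae_eq_diffQuot_of_tendsto (fun n => coeFn_diffQuotMap hS (w n)) hu hyh
  have huq : MemLp (diffQuot γ s u) 2 (μ.prod μ) := (memLp_congr_ae hhu).1 (Lp.memLp h)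
  have hdiff : ∀ n, eLpNorm (diffQuot γ s (w n - u : Lp ℝ 2 μ)) 2 (μ.prod μ) =
      ‖diffQuotMap γ s S hS (w n) - h‖ₑ := fun n => by
    rw [Lp.enorm_def]
    refine eLpNorm_congr_ae ((diffQuot_coeFn_sub γ s _ u).trans (EventuallyEq.trans ?_
      (Lp.coeFn_sub _ _).symm))
    exact (coeFn_diffQuotMap hS (w n)).symm.sub hhu.symm
  have huS : u ∈ (S : Set (Lp ℝ 2 μ)) := by
    refine hW.closed u ((mem_sobolevSpace_iff hγ hs hμ u).2 huq) fun ε hε => ?_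
    have ht : Tendsto (fun n => ‖(w n : Lp ℝ 2 μ) - u‖ₑ +
        ENNReal.ofReal b ^ (1 / 2 : ℝ) * ‖diffQuotMap γ s S hS (w n) - h‖ₑ) atTop (𝓝 0) := by
      have t1 := tendsto_iff_enorm_sub_tendsto_zero.1 hu
      have t2 := tendsto_iff_enorm_sub_tendsto_zero.1 hyh
      simpa using t1.add (ENNReal.Tendsto.const_mul t2 (Or.inr
        (ENNReal.rpow_ne_top_of_nonneg (by norm_num) ENNReal.ofReal_ne_top)))
    obtain ⟨n, hn⟩ := ((tendsto_order.1 ht).2 ε hε).exists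
    refine ⟨w n, (w n).2, lt_of_le_of_lt ?_ hn⟩
    refine add_le_add le_rfl ?_
    refine (ENNReal.rpow_le_rpow (hab _).2 (by norm_num)).trans (le_of_eq ?_)
    rw [ENNReal.mul_rpow_of_nonneg _ _ (by norm_num), hdiff, ← ENNReal.rpow_natCast,
      ← ENNReal.rpow_mul]
    norm_num
  refine ⟨⟨u, huS⟩, Lp.ext ?_⟩
  exact (coeFn_diffQuotMap hS ⟨u, huS⟩).trans hhu.symm

end Coercivity

theorem IsContRep.eq {μ : Measure X} [μ.IsOpenPosMeasure] {v v' : X → ℝ}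
    {w w' : Lp ℝ 2 μ} (h : IsContRep μ v w) (h' : IsContRep μ v' w') (hw : w = w') : v = v' := by
  subst hw
  exact Measure.eq_of_ae_eq (h.2.trans h'.2.symm) h.1 h'.1

theorem dirichletForm_congr_ae {μ : Measure X} [SFinite μ] {γ s : ℝ} {u u' v v' : X → ℝ}
    (hu : u =ᵐ[μ] u') (hv : v =ᵐ[μ] v') :
    dirichletForm μ γ s u v = dirichletForm μ γ s u' v' := by
  refine integral_congr_ae ?_
  filter_upwards [diffQuot_congr_ae γ s hu, diffQuot_congr_ae γ s hv] with z h1 h2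
  rw [dirichletIntegrand_eq_mul, dirichletIntegrand_eq_mul, h1, h2]

/-- Every space of coercivity of order `s/γ` with `s > γ/2` carries a Green function: it is a
Hilbert space for the form `B`, and point evaluation is bounded on it. -/
theorem IsCoercivitySpace.hasGreenFunction [BorelSpace X] {μ : Measure X} {γ s : ℝ} (hγ : 0 < γ)
    (hs : γ / 2 < s) (hμ : AhlforsRegular γ μ) {W : Set (Lp ℝ 2 μ)}
    (hW : IsCoercivitySpace μ (s / γ) W) : HasGreenFunction μ γ s W := by
  have := hμ.sigmaFinite
  have := hμ.secondCountableTopology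
  have := hμ.isOpenPosMeasure
  have hs0 : 0 < s := by linarith
  obtain ⟨S, rfl⟩ := hW.subspace
  have hS : ∀ u ∈ S, MemLp (diffQuot γ s u) 2 (μ.prod μ) := fun u hu =>
    (mem_sobolevSpace_iff hγ hs0 hμ u).1 (hW.subset_sobolev hu)
  obtain ⟨C, hC, hrep⟩ := hμ.exists_continuous_rep hγ hs
  obtain ⟨C', hC', hbd⟩ := hW.exists_norm_le hγ hs0 hμ hS
  have hrep' : ∀ u : S, ∃ v : X → ℝ, IsContRep μ v u ∧
      ∀ x, |v x| ≤ C * (C' + 1) * ‖diffQuotMap γ s S hS u‖ := fun u => by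
    obtain ⟨v, hv, hvu, hle⟩ := hrep u (Lp.memLp _) (hS u u.2)
    refine ⟨v, ⟨hv, hvu⟩, fun x => (hle x).trans ?_⟩
    rw [← norm_diffQuotMap hS, ← Lp.norm_def, mul_assoc]
    have := hbd u
    rw [Submodule.coe_norm] at this
    gcongr
    linarith
  choose rep hrepC hreple using hrep'
  have hadd : ∀ u u' : S, rep (u + u') = rep u + rep u' := fun u u' => by
    refine (hrepC (u + u')).eq (w' := (u + u' : Lp ℝ 2 μ))
      ⟨(hrepC u).1.add (hrepC u').1, ?_⟩ rfl
    exact ((hrepC u).2.add (hrepC u').2).trans (Lp.coeFn_add _ _).symm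
  have hsmul : ∀ (c : ℝ) (u : S), rep (c • u) = c • rep u := fun c u => by
    refine (hrepC (c • u)).eq (w' := (c • u : Lp ℝ 2 μ)) ⟨(hrepC u).1.const_smul c, ?_⟩ rfl
    exact ((hrepC u).2.const_smul c).trans (Lp.coeFn_smul _ _).symm
  have hinj : Function.Injective (diffQuotMap γ s S hS) := by
    refine (injective_iff_map_eq_zero _).2 fun u hu => ?_
    have := hbd u
    rw [hu, norm_zero, mul_zero] at this
    exact norm_le_zero_iff.1 this
  have hriesz : ∀ x : X, ∃ g : S, ∀ v : S,
      ⟪diffQuotMap γ s S hS g, diffQuotMap γ s S hS v⟫ = rep v x := fun x =>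
    exists_forall_inner_map_eq (diffQuotMap γ s S hS) hinj
      (hW.isClosed_range_diffQuotMap hγ hs0 hμ hS)
      { toFun := fun v => rep v x
        map_add' := fun u u' => by rw [hadd]; rfl
        map_smul' := fun c u => by rw [hsmul]; rfl } (C * (C' + 1)) (fun u => hreple u x)
  choose g hg using hriesz
  refine ⟨fun w hw => ⟨rep ⟨w, hw⟩, hrepC ⟨w, hw⟩, fun v hv => hv.eq (hrepC ⟨w, hw⟩) rfl⟩,
    fun x => rep (g x), fun x => ⟨⟨g x, (g x).2, hrepC (g x)⟩, fun w hw v hv => ⟨?_, ?_⟩⟩⟩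
  · have h1 : MemLp (diffQuot γ s (rep (g x))) 2 (μ.prod μ) :=
      (memLp_congr_ae (diffQuot_congr_ae γ s (hrepC (g x)).2)).2 (hS _ (g x).2)
    have h2 : MemLp (diffQuot γ s v) 2 (μ.prod μ) :=
      (memLp_congr_ae (diffQuot_congr_ae γ s hv.2)).2 (hS w hw)
    exact (h1.integrable_mul h2).congr (Eventually.of_forall fun z =>
      (dirichletIntegrand_eq_mul γ s _ _ z).symm)
  · rw [dirichletForm_congr_ae (hrepC (g x)).2 hv.2, hv.eq (hrepC ⟨w, hw⟩) rfl, ← hg x ⟨w, hw⟩,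
      inner_diffQuotMap]

end

variable {X : Type*} [MetricSpace X] [MeasurableSpace X]

/-! ### Geometry of the cubes -/

/-- Cubes of level `j` have diameter at most a multiple of `νʲ` and, since they contain a ball of
radius comparable with `νʲ`, measure at least a multiple of `ν^(jγ)`. -/
theorem IsDyadicSystem.exists_bounds {D : ℤ → Set (Set X)} (hD : IsDyadicSystem D)
    {μ : Measure X} {γ : ℝ} (hγ : 0 < γ) (hμ : AhlforsRegular γ μ) :
    ∃ ν a C : ℝ, 0 < ν ∧ ν < 1 ∧ 0 < a ∧ 0 < C ∧ ∀ j, ∀ Q ∈ D j, μ Q ≠ ∞ ∧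
      (∀ x ∈ Q, ∀ y ∈ Q, dist x y ≤ C * ν ^ j) ∧ a * (ν ^ j) ^ γ ≤ μ.real Q := by
  obtain ⟨ν, c, C, hν0, hν1, hc, hC, h⟩ := hD.metric_control
  obtain ⟨k, hk, hlow⟩ := hμ.exists_le_measureReal_closedBall
  refine ⟨ν, k * (c ^ 2 / 4) ^ γ, C, hν0, hν1, by positivity, hC, fun j Q hQ => ?_⟩
  obtain ⟨h1, h2, h3, -⟩ := h j Q hQ
  have hνj : 0 < ν ^ j := zpow_pos hν0 j
  have hlt : ENNReal.ofReal (c / 2) < eccentricity Q :=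
    ((ENNReal.ofReal_lt_ofReal_iff hc).2 (by linarith)).trans_le h3
  simp only [eccentricity, lt_iSup_iff] at hlt
  obtain ⟨x₁, r₁, x₂, r₂, hr₁, hr₂, hin, hout, hlt⟩ := hlt
  have hbdd : Bornology.IsBounded Q := isBounded_ball.subset hout
  have hfin : μ Q ≠ ∞ := ((measure_mono hout).trans_lt (hμ.measure_ball_lt_top x₂ r₂)).ne
  refine ⟨hfin, fun x hx y hy => (dist_le_diam_of_mem hbdd hx hy).trans h2, ?_⟩
  have hdiam : diam Q ≤ 2 * r₂ := (diam_mono hout isBounded_ball).trans (diam_ball hr₂.le)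
  have hlt' : c / 2 * r₂ < r₁ :=
    (lt_div_iff₀ hr₂).1 ((ENNReal.ofReal_lt_ofReal_iff (by positivity)).1 hlt)
  -- `c ν^j ≤ diam Q ≤ 2 r₂` and `r₁ > (c / 2) r₂`.
  have hrad : c ^ 2 / 4 * ν ^ j ≤ r₁ := by nlinarith
  calc k * (c ^ 2 / 4) ^ γ * (ν ^ j) ^ γ = k * (c ^ 2 / 4 * ν ^ j) ^ γ := by
        rw [Real.mul_rpow (by positivity) hνj.le]; ring
    _ ≤ k * r₁ ^ γ := by gcongr
    _ ≤ μ.real (ball x₁ r₁) := (hlow x₁ r₁ hr₁).1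
    _ ≤ μ.real Q := measureReal_mono hin hfin

theorem IsDyadicSystem.pairwiseDisjoint {D : ℤ → Set (Set X)} (hD : IsDyadicSystem D) (j : ℤ) :
    (D j).PairwiseDisjoint id := (hD.partition j).pairwiseDisjoint

theorem IsDyadicSystem.countable {D : ℤ → Set (Set X)} (hD : IsDyadicSystem D)
    {μ : Measure X} [SFinite μ] {γ : ℝ} (hγ : 0 < γ) (hμ : AhlforsRegular γ μ) (j : ℤ) :
    (D j).Countable := by
  obtain ⟨ν, a, C, hν0, -, ha, -, h⟩ := hD.exists_bounds hγ hμ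
  have hc : Set.Countable {Q : D j | 0 < μ (Q : Set X)} :=
    Measure.countable_meas_pos_of_disjoint_iUnion (fun Q => hD.measurable j Q Q.2)
      (fun P Q hPQ => hD.pairwiseDisjoint j P.2 Q.2 fun hh => hPQ (Subtype.ext hh))
  have hall : {Q : D j | 0 < μ (Q : Set X)} = univ := eq_univ_of_forall fun Q => by
    have hpos : 0 < a * (ν ^ j) ^ γ := by
      have := zpow_pos hν0 j
      positivity
    exact (ENNReal.toReal_pos_iff.1 (hpos.trans_le (h j Q Q.2).2.2)).1
  rw [hall] at hc
  exact Set.countable_coe_iff.1 (countable_univ_iff.1 hc)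

/-! ### The Poincaré inequality -/

/-- The Poincaré inequality on a set `A` of diameter at most `R`, for a function of mean zero. -/
theorem setLIntegral_sq_le_of_integral_eq_zero {μ : Measure X} [SFinite μ] {γ s R m : ℝ}
    (hs : 0 ≤ s + γ / 2) {u : X → ℝ} (hu : MemLp u 2 μ)
    (hq : MemLp (diffQuot γ s u) 2 (μ.prod μ)) {A : Set X} (hA : MeasurableSet A)
    (hμA : μ A ≠ ∞) (hm : 0 < m) (hmA : m ≤ μ.real A) (hR : ∀ x ∈ A, ∀ y ∈ A, dist x y ≤ R)
    (h0 : ∫ x in A, u x ∂μ = 0) :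
    ∫⁻ x in A, ‖u x‖ₑ ^ 2 ∂μ ≤ ENNReal.ofReal ((R ^ (s + γ / 2)) ^ 2 / m) *
      ∫⁻ z in A ×ˢ A, ‖diffQuot γ s u z‖ₑ ^ 2 ∂(μ.prod μ) := by
  have fA : IsFiniteMeasure (μ.restrict A) := ⟨by simpa using hμA.lt_top⟩
  have i1 := integrableOn_of_memLp_two hu hμA
  have i2 : IntegrableOn (fun x => u x ^ 2) A μ := hu.integrable_sq.integrableOn
  have i3 : IntegrableOn (fun z => diffQuot γ s u z ^ 2) (A ×ˢ A) (μ.prod μ) :=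
    hq.integrable_sq.integrableOn
  have hsq : ∀ t : ℝ, ‖t‖ₑ ^ 2 = ENNReal.ofReal (t ^ 2) := fun t => by
    rw [Real.enorm_eq_ofReal_abs, ← ENNReal.ofReal_pow (abs_nonneg _), sq_abs]
  simp only [hsq]
  rw [← ofReal_integral_eq_lintegral_ofReal i2 (Eventually.of_forall fun _ => sq_nonneg _),
    ← ofReal_integral_eq_lintegral_ofReal i3 (Eventually.of_forall fun _ => sq_nonneg _),
    ← ENNReal.ofReal_mul (by positivity)]
  refine ENNReal.ofReal_le_ofReal ?_
  -- Expanding the square, the mixed term is the square of the mean and vanishes.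
  have e : ∫ z in A ×ˢ A, (u z.1 - u z.2) ^ 2 ∂(μ.prod μ) =
      2 * (μ.real A * ∫ x in A, u x ^ 2 ∂μ) := by
    rw [← Measure.prod_restrict]
    have j1 := i2.comp_fst (μ.restrict A)
    have j2 := i2.comp_snd (μ.restrict A)
    have j3 := (i1.mul_prod i1).const_mul 2
    have : ∀ z : X × X, (u z.1 - u z.2) ^ 2 = u z.1 ^ 2 + u z.2 ^ 2 - 2 * (u z.1 * u z.2) :=
      fun z => by ring
    simp only [this]
    have j12 : Integrable (fun z : X × X => u z.1 ^ 2 + u z.2 ^ 2)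
        ((μ.restrict A).prod (μ.restrict A)) := j1.add j2
    rw [integral_sub j12 j3, integral_add j1 j2, integral_const_mul, integral_prod_mul,
      h0, integral_fun_fst (fun x => u x ^ 2), integral_fun_snd (fun x => u x ^ 2)]
    simp only [measureReal_restrict_apply_univ, smul_eq_mul]
    ring
  have hle : ∫ z in A ×ˢ A, (u z.1 - u z.2) ^ 2 ∂(μ.prod μ) ≤
      (R ^ (s + γ / 2)) ^ 2 * ∫ z in A ×ˢ A, diffQuot γ s u z ^ 2 ∂(μ.prod μ) := by
    rw [← integral_const_mul]
    refine integral_mono_of_nonneg (Eventually.of_forall fun _ => sq_nonneg _)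
      (i3.const_mul _) ?_
    filter_upwards [ae_restrict_mem (hA.prod hA)] with z hz
    have := abs_sub_le_diffQuot u hs (hR _ hz.1 _ hz.2)
    have := pow_le_pow_left₀ (abs_nonneg _) this 2
    rwa [mul_pow, sq_abs, sq_abs] at this
  have hI : 0 ≤ ∫ x in A, u x ^ 2 ∂μ := integral_nonneg fun _ => sq_nonneg _
  rw [div_mul_eq_mul_div, le_div_iff₀ hm]
  nlinarith [mul_le_mul_of_nonneg_right hmA hI]

/-- Functions of finite energy whose mean vanishes on every cube of a fixed level satisfy the
coercivity inequality: sum the Poincaré inequality over the cubes. -/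
theorem IsDyadicSystem.exists_coercive [BorelSpace X] {D : ℤ → Set (Set X)}
    (hD : IsDyadicSystem D) {μ : Measure X} [SFinite μ] [SecondCountableTopology X] {γ s : ℝ}
    (hγ : 0 < γ) (hs : 0 < s) (hμ : AhlforsRegular γ μ) (j : ℤ) :
    ∃ c : ℝ, 0 < c ∧ ∀ u ∈ sobolevSpace μ (s / γ), (∀ Q ∈ D j, ∫ x in Q, u x ∂μ = 0) →
      ENNReal.ofReal c * ‖u‖ₑ ^ 2 ≤ energy μ (s / γ) u := by
  obtain ⟨ν, a, C, hν0, -, ha, hC, h⟩ := hD.exists_bounds hγ hμ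
  obtain ⟨b, _, hb, -, hbe⟩ := energy_comparable hγ hs hμ
  have hνj : 0 < ν ^ j := zpow_pos hν0 j
  set K := ((C * ν ^ j) ^ (s + γ / 2)) ^ 2 / (a * (ν ^ j) ^ γ) with hK
  have hK0 : 0 < K := by positivity
  refine ⟨b / K, by positivity, fun u hu h0 => ?_⟩
  have hq := (mem_sobolevSpace_iff hγ hs hμ u).1 hu
  have hcount : Countable (D j) := (hD.countable hγ hμ j).to_subtype
  have hU : ⋃ Q : D j, (Q : Set X) = univ := by
    rw [← sUnion_eq_iUnion]; exact (hD.partition j).sUnion_eq_univ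
  have hdisj : Pairwise (Function.onFun Disjoint fun Q : D j => (Q : Set X)) :=
    fun P Q hPQ => hD.pairwiseDisjoint j P.2 Q.2 fun hh => hPQ (Subtype.ext hh)
  have hmain : ‖u‖ₑ ^ 2 ≤ ENNReal.ofReal K * eLpNorm (diffQuot γ s u) 2 (μ.prod μ) ^ 2 := by
    calc ‖u‖ₑ ^ 2 = ∫⁻ x, ‖u x‖ₑ ^ 2 ∂μ := by
          rw [lintegral_enorm_sq_eq_eLpNorm_sq, Lp.enorm_def]
      _ = ∑' Q : D j, ∫⁻ x in (Q : Set X), ‖u x‖ₑ ^ 2 ∂μ := by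
          rw [← lintegral_iUnion (fun Q : D j => hD.measurable j Q Q.2) hdisj, hU,
            Measure.restrict_univ]
      _ ≤ ∑' Q : D j, ENNReal.ofReal K *
            ∫⁻ z in (Q : Set X) ×ˢ (Q : Set X), ‖diffQuot γ s u z‖ₑ ^ 2 ∂(μ.prod μ) := by
          refine ENNReal.tsum_le_tsum fun Q => ?_
          obtain ⟨g1, g2, g3⟩ := h j Q Q.2
          exact setLIntegral_sq_le_of_integral_eq_zero (by positivity) (Lp.memLp u) hq
            (hD.measurable j Q Q.2) g1 (by positivity) g3 g2 (h0 Q Q.2)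
      _ = ENNReal.ofReal K * ∫⁻ z in ⋃ Q : D j, (Q : Set X) ×ˢ (Q : Set X),
            ‖diffQuot γ s u z‖ₑ ^ 2 ∂(μ.prod μ) := by
          rw [ENNReal.tsum_mul_left, lintegral_iUnion
            (fun Q : D j => (hD.measurable j Q Q.2).prod (hD.measurable j Q Q.2))]
          exact fun P Q hPQ => Disjoint.set_prod_left (hdisj hPQ) _ _
      _ ≤ _ := by
          rw [← lintegral_enorm_sq_eq_eLpNorm_sq]
          gcongr
          exact Measure.restrict_le_self
  calc ENNReal.ofReal (b / K) * ‖u‖ₑ ^ 2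
      ≤ ENNReal.ofReal (b / K) *
        (ENNReal.ofReal K * eLpNorm (diffQuot γ s u) 2 (μ.prod μ) ^ 2) := by gcongr
    _ = ENNReal.ofReal b * eLpNorm (diffQuot γ s u) 2 (μ.prod μ) ^ 2 := by
        rw [← mul_assoc, ← ENNReal.ofReal_mul (by positivity), div_mul_cancel₀ _ hK0.ne']
    _ ≤ _ := (hbe u).1

/-! ### Kernels of projectors -/

theorem inner_eq_zero_of_projector_eq_zero {Y : Type*} [MeasurableSpace Y] {μ : Measure Y}
    {K : Submodule ℝ (Lp ℝ 2 μ)} {u : Lp ℝ 2 μ} (hu : projector K u = 0)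
    {f : Lp ℝ 2 μ} (hf : f ∈ K) : ⟪f, u⟫ = 0 :=
  (Submodule.mem_orthogonal _ _).1 (Submodule.starProjection_apply_eq_zero_iff _ |>.1 hu) f
    (K.le_topologicalClosure hf)

theorem isCoercivitySpace_ker_projector [BorelSpace X] [SecondCountableTopology X] {μ : Measure X}
    [SFinite μ] {γ s : ℝ} (hγ : 0 < γ) (hs : 0 < s) (hμ : AhlforsRegular γ μ)
    (K : Submodule ℝ (Lp ℝ 2 μ))
    (hcoer : ∃ c : ℝ, 0 < c ∧ ∀ u ∈ sobolevSpace μ (s / γ), projector K u = 0 →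
      ENNReal.ofReal c * ‖u‖ₑ ^ 2 ≤ energy μ (s / γ) u) :
    IsCoercivitySpace μ (s / γ) {u | u ∈ sobolevSpace μ (s / γ) ∧ projector K u = 0} where
  subspace := by
    have hmem := mem_sobolevSpace_iff (μ := μ) hγ hs hμ
    refine ⟨{ carrier := {u | u ∈ sobolevSpace μ (s / γ) ∧ projector K u = 0}
              zero_mem' := ⟨(hmem 0).2 ?_, map_zero _⟩
              add_mem' := fun {u v} hu hv => ⟨(hmem _).2 ((memLp_congr_ae
                (diffQuot_coeFn_add γ s u v)).2 (((hmem u).1 hu.1).add ((hmem v).1 hv.1))),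
                by rw [map_add, hu.2, hv.2, add_zero]⟩
              smul_mem' := fun c u hu => ⟨(hmem _).2 ((memLp_congr_ae
                (diffQuot_coeFn_smul γ s c u)).2 (((hmem u).1 hu.1).const_smul c)),
                by rw [map_smul, hu.2, smul_zero]⟩ }, rfl⟩
    have h0 : diffQuot γ s (0 : X → ℝ) = 0 := by ext z; simp [diffQuot]
    refine (memLp_congr_ae (diffQuot_congr_ae γ s (Lp.coeFn_zero ℝ 2 μ))).2 ?_
    rw [h0]
    exact MemLp.zero
  subset_sobolev := fun u hu => hu.1
  closed := fun u hu happ => by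
    refine ⟨hu, ?_⟩
    have hcl : IsClosed {v : Lp ℝ 2 μ | projector K v = 0} :=
      isClosed_eq (projector K).continuous continuous_const
    refine hcl.closure_subset (EMetric.mem_closure_iff.2 fun ε hε => ?_)
    obtain ⟨w, hw, hlt⟩ := happ ε hε
    refine ⟨w, hw.2, ?_⟩
    rw [edist_comm, edist_eq_enorm_sub]
    exact lt_of_le_of_lt le_self_add hlt
  coercive := by
    obtain ⟨c, hc, h⟩ := hcoer
    exact ⟨c, hc, fun u hu => h u hu.1 hu.2⟩

/-- For a disjoint family, the indicator of a member is constant on each member. -/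
theorem indicatorConstLp_mem_constOn {Y : Type*} [MeasurableSpace Y] {μ : Measure Y}
    {F : Set (Set Y)} (hF : F.PairwiseDisjoint id) {Q : Set Y} (hQ : Q ∈ F)
    (hm : MeasurableSet Q) (hfin : μ Q ≠ ∞) :
    indicatorConstLp 2 hm hfin (1 : ℝ) ∈ constOn μ F := by
  intro Q' hQ'
  rcases eq_or_ne Q Q' with rfl | hne
  · refine ⟨1, ?_⟩
    filter_upwards [indicatorConstLp_coeFn (p := 2) (hs := hm) (hμs := hfin) (c := (1 : ℝ))]
      with x hx hxQ
    rw [hx, indicator_of_mem hxQ]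
  · refine ⟨0, ?_⟩
    filter_upwards [indicatorConstLp_coeFn (p := 2) (hs := hm) (hμs := hfin) (c := (1 : ℝ))]
      with x hx hxQ
    have hxQ1 : x ∉ Q := fun hxQ1 => (hF hQ hQ' hne).le_bot ⟨hxQ1, hxQ⟩
    rw [hx, indicator_of_notMem hxQ1]

theorem IsDyadicSystem.isCoercivitySpace_levelKernelSpace [BorelSpace X] {D : ℤ → Set (Set X)}
    (hD : IsDyadicSystem D) {μ : Measure X} {γ s : ℝ} (hγ : 0 < γ) (hs : 0 < s)
    (hμ : AhlforsRegular γ μ) (j : ℤ) :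
    IsCoercivitySpace μ (s / γ) (levelKernelSpace μ (s / γ) D j) := by
  have := hμ.sigmaFinite
  have := hμ.secondCountableTopology
  obtain ⟨ν, a, C, -, -, -, -, h⟩ := hD.exists_bounds hγ hμ
  obtain ⟨c, hc, hcoer⟩ := hD.exists_coercive hγ hs hμ j
  refine isCoercivitySpace_ker_projector hγ hs hμ _ ⟨c, hc, fun u hu hPu => ?_⟩
  refine hcoer u hu fun Q hQ => ?_
  rw [← L2.inner_indicatorConstLp_one (𝕜 := ℝ) (hD.measurable j Q hQ) (h j Q hQ).1]
  exact inner_eq_zero_of_projector_eq_zero hPu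
    (indicatorConstLp_mem_constOn (hD.pairwiseDisjoint j) hQ _ _)

/-! ### The kernel of the Haar projector -/

/-- A function orthogonal to the Haar functions of the cube `P` has the same mean on `P` and on
each child `Q` of `P`: the indicator of `Q` is, modulo the span of these Haar functions, the multiple
`μ(Q) / μ(P)` of the indicator of `P`. -/
theorem IsHaarSystem.measureReal_mul_setIntegral_eq {D : ℤ → Set (Set X)} (hD : IsDyadicSystem D)
    {μ : Measure X} {H : ℤ → Set X → Set (Lp ℝ 2 μ)} (hH : IsHaarSystem μ D H) {i : ℤ}
    {P Q : Set X} (hP : P ∈ D i) (hQ : Q ∈ D (i + 1)) (hQP : Q ⊆ P) (hfin : μ P ≠ ∞)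
    (hpos : 0 < μ.real P) {u : Lp ℝ 2 μ} (hu : ∀ h ∈ H i P, ⟪h, u⟫ = 0) :
    μ.real P * ∫ x in Q, u x ∂μ = μ.real Q * ∫ x in P, u x ∂μ := by
  obtain ⟨e, he, heH, horth, hspan⟩ := hH i P hP
  have mP := hD.measurable i P hP
  have mQ := hD.measurable (i + 1) Q hQ
  have finQ : μ Q ≠ ∞ := ne_top_of_le_ne_top hfin (measure_mono hQP)
  set f := indicatorConstLp 2 mQ finQ (1 : ℝ) with hf
  set g := indicatorConstLp 2 mP hfin (1 : ℝ) with hg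
  have heg : e = (1 / √(μ.real P)) • g := by
    refine Lp.ext (he.trans ?_)
    filter_upwards [Lp.coeFn_smul (1 / √(μ.real P)) g,
      indicatorConstLp_coeFn (p := 2) (hs := mP) (hμs := hfin) (c := (1 : ℝ))] with x h1 h2
    rw [h1, Pi.smul_apply, h2]
    by_cases hx : x ∈ P <;> simp [hx]
  have hfmem : f ∈ Submodule.span ℝ (insert e (H i P)) := by
    rw [hspan]
    refine ⟨?_, indicatorConstLp_mem_constOn ((hD.pairwiseDisjoint (i + 1)).subset
      fun _ h => h.1) (show Q ∈ offspring D i P from ⟨hQ, hQP⟩) mQ finQ⟩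
    change ∀ᵐ x ∂μ, x ∉ P → f x = 0
    filter_upwards [indicatorConstLp_coeFn (p := 2) (hs := mQ) (hμs := finQ) (c := (1 : ℝ))]
      with x hx hxP
    rw [hx, indicator_of_notMem fun hxQ => hxP (hQP hxQ)]
  obtain ⟨t, z, hz, hfz⟩ := Submodule.mem_span_insert.1 hfmem
  have hzero : ∀ w : Lp ℝ 2 μ, (∀ h ∈ H i P, ⟪h, w⟫ = 0) → ⟪z, w⟫ = 0 := fun w hw => by
    clear hfz
    induction hz using Submodule.span_induction with
    | mem h hh => exact hw h hh
    | zero => exact inner_zero_left _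
    | add a b _ _ ha hb => rw [inner_add_left, ha, hb, add_zero]
    | smul c a _ ha => rw [inner_smul_left, ha, mul_zero]
  have hee : ⟪e, e⟫ = 1 := by
    rw [real_inner_self_eq_norm_sq, horth.1 ⟨e, mem_insert _ _⟩, one_pow]
  have hze : ⟪z, e⟫ = 0 := hzero e fun h hh =>
    horth.2 (i := ⟨h, mem_insert_of_mem _ hh⟩) (j := ⟨e, mem_insert _ _⟩) fun heq => by
      rw [Subtype.mk.injEq] at heq
      exact heH (heq ▸ hh)
  have ht : t = ⟪f, e⟫ := by
    rw [hfz, inner_add_left, inner_smul_left, hee, hze]; simp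
  have hfu : ⟪f, u⟫ = t * ⟪e, u⟫ := by
    rw [hfz, inner_add_left, inner_smul_left, hzero u hu]; simp
  have hfg : ⟪f, g⟫ = μ.real Q := by
    rw [hf, L2.inner_indicatorConstLp_one, hg, setIntegral_indicatorConstLp mQ,
      inter_eq_self_of_subset_right hQP, smul_eq_mul, mul_one]
  rw [ht, heg, inner_smul_right, inner_smul_left, hfg, hf, hg, L2.inner_indicatorConstLp_one,
    L2.inner_indicatorConstLp_one] at hfu
  rw [hfu]
  have hsqrt := Real.mul_self_sqrt hpos.le
  have hne := (Real.sqrt_pos.2 hpos).ne'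
  simp only [conj_trivial]
  nth_rewrite 1 [← hsqrt]
  field_simp

/-- If all cubes of level at most `j` have measure larger than `t`, then a function in the kernel
of `Π_t` has the same mean on a cube of level `j` and on its ancestors. These means tend to `0`, as
the measures of the ancestors tend to `∞`. -/
theorem IsHaarSystem.setIntegral_eq_zero {D : ℤ → Set (Set X)} (hD : IsDyadicSystem D)
    {μ : Measure X} {H : ℤ → Set X → Set (Lp ℝ 2 μ)} (hH : IsHaarSystem μ D H) {γ t : ℝ}
    (hγ : 0 < γ) (hμ : AhlforsRegular γ μ) {j : ℤ}
    (hj : ∀ i ≤ j, ∀ Q ∈ D i, ENNReal.ofReal t < μ Q) {u : Lp ℝ 2 μ}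
    (hu : haarProjector μ D H t u = 0) {Q : Set X} (hQ : Q ∈ D j) :
    ∫ x in Q, u x ∂μ = 0 := by
  obtain ⟨ν, a, C, hν0, hν1, ha, -, h⟩ := hD.exists_bounds hγ hμ
  have hpos : ∀ i, ∀ P ∈ D i, 0 < μ.real P := fun i P hP => by
    have := zpow_pos hν0 i
    exact lt_of_lt_of_le (by positivity) (h i P hP).2.2
  have hanc : ∀ n : ℕ, ∃ P ∈ D (j - n),
      μ.real P * ∫ x in Q, u x ∂μ = μ.real Q * ∫ x in P, u x ∂μ := fun n => by
    induction n with
    | zero => exact ⟨Q, by simpa using hQ, rfl⟩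
    | succ n ih =>
      obtain ⟨P, hP, hPQ⟩ := ih
      have hidx : j - (n : ℤ) = j - ((n + 1 : ℕ) : ℤ) + 1 := by push_cast; ring
      have hP' := hP
      rw [hidx] at hP'
      obtain ⟨P', ⟨hP'mem, hsub⟩, -⟩ := hD.parent _ P hP'
      refine ⟨P', hP'mem, ?_⟩
      have hstep := hH.measureReal_mul_setIntegral_eq hD hP'mem hP' hsub (h _ _ hP'mem).1
        (hpos _ _ hP'mem) (u := u) fun f hf => inner_eq_zero_of_projector_eq_zero hu
          (Submodule.subset_span ⟨_, P', hP'mem, hj _ (by omega) P' hP'mem, hf⟩)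
      refine mul_left_cancel₀ (hpos _ _ hP).ne' ?_
      linear_combination μ.real P' * hPQ + μ.real Q * hstep
  by_contra hne
  set I := ∫ x in Q, u x ∂μ with hI
  have hνj : 0 < (ν ^ j) ^ γ := by
    have := zpow_pos hν0 j
    positivity
  have hb : 1 < (ν ^ γ)⁻¹ :=
    (one_lt_inv₀ (Real.rpow_pos_of_pos hν0 _)).2 (Real.rpow_lt_one hν0.le hν1 hγ)
  have hIsq : 0 < I ^ 2 := by positivity
  obtain ⟨n, hn⟩ := pow_unbounded_of_one_lt
    ((μ.real Q * ‖u‖) ^ 2 / (a * (ν ^ j) ^ γ * I ^ 2)) hb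
  obtain ⟨P, hP, hPQ⟩ := hanc n
  obtain ⟨hfin, -, hlow⟩ := h _ P hP
  have hPpos := hpos _ P hP
  have hcs : |∫ x in P, u x ∂μ| ≤ √(μ.real P) * ‖u‖ :=
    (norm_integral_le_integral_norm _).trans
      (setIntegral_norm_le_sqrt_mul (Lp.memLp u) (hD.measurable _ P hP) hfin)
  have hsq : μ.real P * I ^ 2 ≤ (μ.real Q * ‖u‖) ^ 2 := by
    have h1 : (∫ x in P, u x ∂μ) ^ 2 ≤ μ.real P * ‖u‖ ^ 2 := by
      have := pow_le_pow_left₀ (abs_nonneg _) hcs 2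
      rwa [sq_abs, mul_pow, Real.sq_sqrt hPpos.le] at this
    refine le_of_mul_le_mul_left ?_ hPpos
    calc μ.real P * (μ.real P * I ^ 2) = (μ.real Q * ∫ x in P, u x ∂μ) ^ 2 := by
          rw [← hPQ]; ring
      _ = μ.real Q ^ 2 * (∫ x in P, u x ∂μ) ^ 2 := by ring
      _ ≤ μ.real Q ^ 2 * (μ.real P * ‖u‖ ^ 2) := by gcongr
      _ = _ := by ring
  have hpow : (ν ^ (j - (n : ℤ))) ^ γ = (ν ^ j) ^ γ * ((ν ^ γ)⁻¹) ^ n := by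
    rw [zpow_sub₀ hν0.ne', Real.div_rpow (by positivity) (by positivity), zpow_natCast, inv_pow,
      div_eq_mul_inv, ← Real.rpow_natCast, ← Real.rpow_natCast, ← Real.rpow_mul hν0.le,
      ← Real.rpow_mul hν0.le, mul_comm (n : ℝ)]
  rw [hpow] at hlow
  rw [div_lt_iff₀ (by positivity)] at hn
  have := mul_le_mul_of_nonneg_right hlow hIsq.le
  linarith

theorem IsHaarSystem.isCoercivitySpace_haarKernelSpace [BorelSpace X] {D : ℤ → Set (Set X)}
    (hD : IsDyadicSystem D) {μ : Measure X} {H : ℤ → Set X → Set (Lp ℝ 2 μ)}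
    (hH : IsHaarSystem μ D H) {γ s : ℝ} (hγ : 0 < γ) (hs : 0 < s) (hμ : AhlforsRegular γ μ)
    {t : ℝ} (ht : 0 < t) :
    IsCoercivitySpace μ (s / γ) (haarKernelSpace μ (s / γ) D H t) := by
  have := hμ.sigmaFinite
  have := hμ.secondCountableTopology
  obtain ⟨ν, a, C, hν0, hν1, ha, -, h⟩ := hD.exists_bounds hγ hμ
  have hb : 1 < (ν ^ γ)⁻¹ :=
    (one_lt_inv₀ (Real.rpow_pos_of_pos hν0 _)).2 (Real.rpow_lt_one hν0.le hν1 hγ)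
  obtain ⟨n, hn⟩ := pow_unbounded_of_one_lt (t / a) hb
  have hj : ∀ i ≤ -(n : ℤ), ∀ Q ∈ D i, ENNReal.ofReal t < μ Q := fun i hi Q hQ => by
    rw [ENNReal.ofReal_lt_iff_lt_toReal ht.le (h i Q hQ).1]
    refine lt_of_lt_of_le ?_ (h i Q hQ).2.2
    rw [div_lt_iff₀' ha] at hn
    refine hn.trans_le ?_
    have hmono : ν ^ (-(n : ℤ)) ≤ ν ^ i := zpow_le_zpow_right_of_le_one₀ hν0 hν1.le hi
    have hpow : ((ν ^ γ)⁻¹) ^ n = (ν ^ (-(n : ℤ))) ^ γ := by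
      rw [zpow_neg, Real.inv_rpow (by positivity), zpow_natCast, inv_pow, ← Real.rpow_natCast,
        ← Real.rpow_natCast, ← Real.rpow_mul hν0.le, ← Real.rpow_mul hν0.le, mul_comm (n : ℝ)]
    rw [hpow]
    gcongr
  obtain ⟨c, hc, hcoer⟩ := hD.exists_coercive hγ hs hμ (-(n : ℤ))
  exact isCoercivitySpace_ker_projector hγ hs hμ _ ⟨c, hc, fun u hu hPu =>
    hcoer u hu fun Q hQ => hH.setIntegral_eq_zero hD hγ hμ hj hPu hQ⟩

end FracGreen

theorem theorem5p2 {X : Type*} [MetricSpace X] [MeasurableSpace X] [BorelSpace X]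
    (μ : MeasureTheory.Measure X) (γ s : ℝ) (hγ : 0 < γ) (hμ : FracGreen.AhlforsRegular γ μ)
    (hs : γ / 2 < s) :
    -- every space of coercivity carries a Green function
    (∀ W : Set (MeasureTheory.Lp ℝ 2 μ), FracGreen.IsCoercivitySpace μ (s / γ) W →
      FracGreen.HasGreenFunction μ γ s W) ∧
    -- the dyadic spaces are spaces of coercivity, and so they carry Green functions
    (∀ D : ℤ → Set (Set X), FracGreen.IsDyadicSystem D →
      (∀ j : ℤ,
        FracGreen.IsCoercivitySpace μ (s / γ) (FracGreen.levelKernelSpace μ (s / γ) D j) ∧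
        FracGreen.HasGreenFunction μ γ s (FracGreen.levelKernelSpace μ (s / γ) D j)) ∧
      (∀ H : ℤ → Set X → Set (MeasureTheory.Lp ℝ 2 μ), FracGreen.IsHaarSystem μ D H →
        ∀ t : ℝ, 0 < t →
          FracGreen.IsCoercivitySpace μ (s / γ) (FracGreen.haarKernelSpace μ (s / γ) D H t) ∧
          FracGreen.HasGreenFunction μ γ s (FracGreen.haarKernelSpace μ (s / γ) D H t))) := by
  have hs0 : 0 < s := by linarith
  have hgreen : ∀ W : Set (MeasureTheory.Lp ℝ 2 μ), FracGreen.IsCoercivitySpace μ (s / γ) W →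
      FracGreen.HasGreenFunction μ γ s W := fun W hW => hW.hasGreenFunction hγ hs hμ
  refine ⟨hgreen, fun D hD => ⟨fun j => ?_, fun H hH t ht => ?_⟩⟩
  · have h := hD.isCoercivitySpace_levelKernelSpace hγ hs0 hμ j
    exact ⟨h, hgreen _ h⟩
  · have h := hH.isCoercivitySpace_haarKernelSpace hD hγ hs0 hμ ht
    exact ⟨h, hgreen _ h⟩
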